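/- **Theorem (Hamiltonian not in extended span, HNES).** Let $\mathcal H_E$ (environment) and $\mathcal H_P$ (probe) be finite-dimensional complex Hilbert spaces, $d_E=\dim\mathcal H_E\ge 1$. For every finite-dimensional auxiliary space $\mathcal H_A$, let a state $\rho$ on $\mathcal H_E\otimes\mathcal H_P\otimes\mathcal H_A$ evolve by $$\frac{d\rho}{dt}=-\mathrm i[H_{EP},\rho]-\mathrm i\omega[\mathbb 1_E\otimes G\otimes\mathbb 1_A,\rho]-\mathrm i\omega[H_E\otimes\mathbb 1_P\otimes\mathbb 1_A,\rho]+\sum_{k=1}^r\Big(L_k\rho L_k^\dagger-\tfrac12\{L_k^\dagger L_k,\rho\}\Big),$$ where $H_{EP}$, $G$, $H_E$ are Hermitian operators on $\mathcal H_E\otimes\mathcal H_P$, $\mathcal H_P$, $\mathcal H_E$, the $L_k$ are arbitrary operators on $\mathcal H_E\otimes\mathcal H_P$, $H_{EP}$ and $L_k$ act trivially on $\mathcal H_A$, and $\omega\in\mathbb R$ is the parameter to be estimated. Let $\Phi^{\omega}_{t}$ denote the resulting evolution for time $t$. Let $\{|\phi_i\rangle\}_{i=1}^{d_E}$ be an orthonormal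 basis of $\mathcal H_E$ and let $\mathcal S$ be the complex linear span of $\mathbb 1_P$ and of all operators $\langle\phi_i|H_{EP}|\phi_m\rangle$, $\langle\phi_i|L_k|\phi_m\rangle$, $\langle\phi_i|L_k^\dagger|\phi_m\rangle$ and $\langle\phi_i|L_k^\dagger|\phi_m\rangle\langle\phi_n|L_j|\phi_l\rangle$ on $\mathcal H_P$. If $G\notin\mathcal S$, then Heisenberg-limit scaling in $\omega$ is achieved by fast quantum error correction on probe and auxiliary system. That is, there are a finite-dimensional noiseless auxiliary space $\mathcal H_A$, orthonormal vectors $|C_0\rangle,|C_1\rangle\in\mathcal H_P\otimes\mathcal H_A$ with $P=|C_0\rangle\langle C_0|+|C_1\rangle\langle C_1|$, real numbers $\lambda_0\neq\lambda_1$ with $P(G\otimes\mathbb 1_A)P|C_i\rangle=\lambda_i|C_i\rangle$ for $i=0,1$, and a completely positive trace-preserving map $\mathcal R$ on the operators on $\mathcal H_P\otimes\mathcal H_A$ with outputs supported on the code space, $P\mathcal R(X)P=\mathcal R(X)$ for all $X$, none of them depending on $\omega$, on time or on the initial environment state, such that the following holds. Let $\mathcal D(X)=PXP+\mathcal R\big((\mathbb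 1-P)X(\mathbb 1-P)\big)$ and $|\psi\rangle=(|C_0\rangle+|C_1\rangle)/\sqrt2$. For every density matrix $\rho_E$ on $\mathcal H_E$, every $\omega\in\mathbb R$ and every $t\ge0$ the limit of infinitely fast error correction $$\rho_{PA}(\omega,t)=\lim_{N\to\infty}\operatorname{Tr}_E\Big[\big((\mathrm{id}_E\otimes\mathcal D)\circ\Phi^{\omega}_{t/N}\big)^{N}\big(\rho_E\otimes|\psi\rangle\langle\psi|\big)\Big]$$ exists, is a density matrix, is differentiable in $\omega$, and has quantum Fisher information about $\omega$ $$\mathcal F\big(\rho_{PA}(\omega,t)\big)=t^2(\lambda_0-\lambda_1)^2 .$$ Here $\mathcal F(\rho)=2\sum_{i,j:\,\gamma_i+\gamma_j>0}\frac{|\langle\gamma_i|\partial_\omega\rho|\gamma_j\rangle|^2}{\gamma_i+\gamma_j}$, where $\gamma_i$ are the eigenvalues of $\rho$ and $|\gamma_i\rangle$ is a corresponding orthonormal eigenbasis. -/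

import Mathlib

open scoped Kronecker Topology ComplexOrder

noncomputable section

namespace HiddenMarkovMetrology

/-- The data of the hidden Markov model on `ℋ_E ⊗ ℋ_P`, with `ℋ_E = ℂ^E`, `ℋ_P = ℂ^P`:
the coupling Hamiltonian, the signal on the probe, the signal on the environment
and the `r` jump operators. -/
structure Model (E P : Type*) (r : ℕ) where
  HEP : Matrix (E × P) (E × P) ℂ
  G : Matrix P P ℂ
  HE : Matrix E E ℂ
  L : Fin r → Matrix (E × P) (E × P) ℂ
  HEP_isHermitian : HEP.IsHermitian
  G_isHermitian : G.IsHermitian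
  HE_isHermitian : HE.IsHermitian

section Basic

variable {E P A m n : Type*}
variable [Fintype E] [DecidableEq E] [Fintype P] [DecidableEq P] [Fintype A] [DecidableEq A]
variable [Fintype m] [DecidableEq m] [Fintype n] [DecidableEq n]

/-- The operator `⟨φ_i| X |φ_j⟩` on the probe. -/
def probeBlock {ι : Type*} [Fintype ι] (φ : OrthonormalBasis ι ℂ (EuclideanSpace ℂ E))
    (X : Matrix (E × P) (E × P) ℂ) (i j : ι) : Matrix P P ℂ :=
  Matrix.of fun p q => ∑ e, ∑ e', star (φ i e) * X (e, p) (e', q) * φ j e'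

/-- The extended span: the complex linear span of `1_P` and of the operators
`⟨φ_i|H_EP|φ_m⟩`, `⟨φ_i|L_k|φ_m⟩`, `⟨φ_i|L_k†|φ_m⟩`, `⟨φ_i|L_k†|φ_m⟩⟨φ_n|L_j|φ_l⟩`. -/
def extendedSpan {ι : Type*} [Fintype ι] {r : ℕ} (M : Model E P r)
    (φ : OrthonormalBasis ι ℂ (EuclideanSpace ℂ E)) : Submodule ℂ (Matrix P P ℂ) :=
  Submodule.span ℂ
    ({1} ∪ {X | ∃ i m, X = probeBlock φ M.HEP i m}
      ∪ {X | ∃ k i m, X = probeBlock φ (M.L k) i m}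
      ∪ {X | ∃ k i m, X = probeBlock φ (M.L k).conjTranspose i m}
      ∪ {X | ∃ k j i m n l,
          X = probeBlock φ (M.L k).conjTranspose i m * probeBlock φ (M.L j) n l})

/-- An operator on `E ⊗ P`, acting trivially on the auxiliary system. -/
def liftEP (A : Type*) [DecidableEq A] (X : Matrix (E × P) (E × P) ℂ) :
    Matrix (E × (P × A)) (E × (P × A)) ℂ :=
  (X ⊗ₖ (1 : Matrix A A ℂ)).reindex (Equiv.prodAssoc E P A) (Equiv.prodAssoc E P A)

/-- An operator on the probe, acting trivially on the auxiliary system. -/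
def liftP (A : Type*) [DecidableEq A] (X : Matrix P P ℂ) : Matrix (P × A) (P × A) ℂ :=
  X ⊗ₖ (1 : Matrix A A ℂ)

/-- The superoperator `ρ ↦ -i[H, ρ]`. -/
def hamiltonianTerm (H : Matrix n n ℂ) : Matrix n n ℂ →ₗ[ℂ] Matrix n n ℂ :=
  (-Complex.I) • (LinearMap.mulLeft ℂ H - LinearMap.mulRight ℂ H)

/-- The superoperator `ρ ↦ L ρ L† - (1/2) {L† L, ρ}`. -/
def dissipator (L : Matrix n n ℂ) : Matrix n n ℂ →ₗ[ℂ] Matrix n n ℂ :=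
  LinearMap.mulLeft ℂ L ∘ₗ LinearMap.mulRight ℂ L.conjTranspose
    - (1 / 2 : ℂ) • (LinearMap.mulLeft ℂ (L.conjTranspose * L)
        + LinearMap.mulRight ℂ (L.conjTranspose * L))

/-- The right-hand side of the master equation on environment, probe and auxiliary system, at the
parameter value `ω`. -/
def lindbladian {r : ℕ} (M : Model E P r) (A : Type*) [Fintype A] [DecidableEq A] (ω : ℝ) :
    Matrix (E × (P × A)) (E × (P × A)) ℂ →ₗ[ℂ] Matrix (E × (P × A)) (E × (P × A)) ℂ :=
  hamiltonianTerm (liftEP A M.HEP)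
    + (ω : ℂ) • hamiltonianTerm ((1 : Matrix E E ℂ) ⊗ₖ liftP A M.G)
    + (ω : ℂ) • hamiltonianTerm (M.HE ⊗ₖ (1 : Matrix (P × A) (P × A) ℂ))
    + ∑ k, dissipator (liftEP A (M.L k))

/-- The semigroup `exp (t 𝓛)` generated by a superoperator `𝓛`; the exponential is that of the
matrix of `𝓛` in the standard basis of matrix units. -/
def semigroup (𝓛 : Matrix n n ℂ →ₗ[ℂ] Matrix n n ℂ) (t : ℝ) :
    Matrix n n ℂ →ₗ[ℂ] Matrix n n ℂ :=
  Matrix.toLin (Matrix.stdBasis ℂ n n) (Matrix.stdBasis ℂ n n)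
    (NormedSpace.exp (t • LinearMap.toMatrix (Matrix.stdBasis ℂ n n)
      (Matrix.stdBasis ℂ n n) 𝓛))

/-- `t ↦ exp (t 𝓛) X` starts at `X`. -/
theorem semigroup_zero (𝓛 : Matrix n n ℂ →ₗ[ℂ] Matrix n n ℂ) (X : Matrix n n ℂ) :
    semigroup 𝓛 0 X = X := by
  simp [semigroup, NormedSpace.exp_zero]

section Norm

attribute [local instance] Matrix.linftyOpNormedRing Matrix.linftyOpNormedAlgebra

/-- `t ↦ exp (t 𝓛) X` solves the equation `dρ/dt = 𝓛 ρ`. -/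
theorem hasDerivAt_semigroup (𝓛 : Matrix n n ℂ →ₗ[ℂ] Matrix n n ℂ) (X : Matrix n n ℂ) (t : ℝ)
    (a b : n) :
    HasDerivAt (fun s : ℝ => semigroup 𝓛 s X a b) (𝓛 (semigroup 𝓛 t X) a b) t := by
  set B := Matrix.stdBasis ℂ n n
  set K := LinearMap.toMatrix B B 𝓛 with hK
  have h : HasDerivAt (fun s : ℝ => NormedSpace.exp (s • K))
      (K * NormedSpace.exp (t • K)) t :=
    hasDerivAt_exp_smul_const' (𝕂 := ℝ) K t
  let ev : Matrix (n × n) (n × n) ℂ →ₗ[ℝ] ℂ :=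
    { toFun := fun Y => Matrix.toLin B B Y X a b
      map_add' := by intro Y Z; simp
      map_smul' := by
        intro c Y
        have : c • Y = (c : ℂ) • Y := by ext; simp
        rw [this, map_smul]
        simp }
  have h2 := (LinearMap.toContinuousLinearMap ev).hasFDerivAt.comp_hasDerivAt t h
  have e : 𝓛 (semigroup 𝓛 t X) a b = ev (K * NormedSpace.exp (t • K)) := by
    change _ = Matrix.toLin B B _ X a b
    rw [Matrix.toLin_mul B B B, hK, Matrix.toLin_toMatrix]
    rfl
  rw [e]
  exact h2

end Norm

/-- A density matrix. -/
def IsDensityMatrix (ρ : Matrix n n ℂ) : Prop := ρ.PosSemidef ∧ ρ.trace = 1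

/-- The map `id ⊗ D`, applying the superoperator `D` to the second tensor factor. -/
def onSecond {m n : Type*} (F : Type*) (D : Matrix m m ℂ →ₗ[ℂ] Matrix n n ℂ)
    (X : Matrix (F × m) (F × m) ℂ) : Matrix (F × n) (F × n) ℂ :=
  Matrix.of fun x y => D (Matrix.of fun a b => X (x.1, a) (y.1, b)) x.2 y.2

/-- A completely positive trace-preserving map. -/
def IsCPTP (D : Matrix n n ℂ →ₗ[ℂ] Matrix n n ℂ) : Prop :=
  (∀ (d : ℕ) (X : Matrix (Fin d × n) (Fin d × n) ℂ),
      X.PosSemidef → (onSecond (Fin d) D X).PosSemidef) ∧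
    ∀ X, (D X).trace = X.trace

/-- The rank-one operator `|v⟩⟨v|`. -/
def ketBra (v : n → ℂ) : Matrix n n ℂ := Matrix.vecMulVec v (star v)

/-- The projector `|C₀⟩⟨C₀| + |C₁⟩⟨C₁|` onto the code space spanned by `C₀`, `C₁`. -/
def codeProj (C₀ C₁ : n → ℂ) : Matrix n n ℂ := ketBra C₀ + ketBra C₁

/-- `C₀`, `C₁` are orthonormal. -/
def IsOrthonormalPair (C₀ C₁ : n → ℂ) : Prop :=
  star C₀ ⬝ᵥ C₀ = 1 ∧ star C₁ ⬝ᵥ C₁ = 1 ∧ star C₀ ⬝ᵥ C₁ = 0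

/-- One step of error correction for the code with projector `Q`: measure whether the state is in
the code space, and apply the recovery `R` if it is not. -/
def qecStep (Q : Matrix n n ℂ) (R : Matrix n n ℂ →ₗ[ℂ] Matrix n n ℂ) :
    Matrix n n ℂ →ₗ[ℂ] Matrix n n ℂ :=
  LinearMap.mulLeft ℂ Q ∘ₗ LinearMap.mulRight ℂ Q
    + R ∘ₗ LinearMap.mulLeft ℂ (1 - Q) ∘ₗ LinearMap.mulRight ℂ (1 - Q)

/-- `R` is a recovery operation for the code with projector `Q`: a CPTP map whose outputs are
supported on the code space. -/
def IsRecovery (Q : Matrix n n ℂ) (R : Matrix n n ℂ →ₗ[ℂ] Matrix n n ℂ) : Prop :=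
  IsCPTP R ∧ ∀ X, Q * R X * Q = R X

/-- Free evolution for a time `τ` at parameter value `ω`, followed by the control `D` on probe and
auxiliary system; the environment is not touched by the control. -/
def controlledRound {r : ℕ} (M : Model E P r) (D : Matrix (P × A) (P × A) ℂ →ₗ[ℂ]
    Matrix (P × A) (P × A) ℂ) (ω τ : ℝ) (X : Matrix (E × (P × A)) (E × (P × A)) ℂ) :
    Matrix (E × (P × A)) (E × (P × A)) ℂ :=
  onSecond E D (semigroup (lindbladian M A ω) τ X)

/-- The partial trace over the environment. -/
def traceEnv (X : Matrix (E × n) (E × n) ℂ) : Matrix n n ℂ :=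
  Matrix.of fun a b => ∑ e, X (e, a) (e, b)

/-- The state of probe and auxiliary system at time `t`, when the control `D` is applied `N` times
at equal time intervals `t / N`, from the initial state `ρE ⊗ ρ₀`. -/
def controlledState {r : ℕ} (M : Model E P r) (D : Matrix (P × A) (P × A) ℂ →ₗ[ℂ]
    Matrix (P × A) (P × A) ℂ) (ρE : Matrix E E ℂ) (ρ₀ : Matrix (P × A) (P × A) ℂ)
    (ω t : ℝ) (N : ℕ) : Matrix (P × A) (P × A) ℂ :=
  traceEnv ((controlledRound M D ω (t / N))^[N] (ρE ⊗ₖ ρ₀))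

/-- `ρ ω t` is the state of probe and auxiliary system at time `t` when the control `D` is applied
infinitely fast: the limit of the states for `N` equally spaced applications. -/
def IsFastControlState {r : ℕ} (M : Model E P r) (D : Matrix (P × A) (P × A) ℂ →ₗ[ℂ]
    Matrix (P × A) (P × A) ℂ) (ρE : Matrix E E ℂ) (ρ₀ : Matrix (P × A) (P × A) ℂ)
    (ρ : ℝ → ℝ → Matrix (P × A) (P × A) ℂ) : Prop :=
  ∀ ω t : ℝ, 0 ≤ t →
    Filter.Tendsto (fun N : ℕ => controlledState M D ρE ρ₀ ω t N) Filter.atTop (𝓝 (ρ ω t))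

/-- The quantum Fisher information of a state `ρ` with derivative `ρ'` in the parameter:
`2 ∑ |⟨γ_i|ρ'|γ_j⟩|² / (γ_i + γ_j)`, over the pairs of eigenvectors of `ρ` whose eigenvalues have
positive sum. -/
def qfi (ρ : Matrix n n ℂ) (hρ : ρ.IsHermitian) (ρ' : Matrix n n ℂ) : ℝ :=
  2 * ∑ i, ∑ j, if 0 < hρ.eigenvalues i + hρ.eigenvalues j then
    ‖star (hρ.eigenvectorBasis i).ofLp ⬝ᵥ Matrix.mulVec ρ' (hρ.eigenvectorBasis j).ofLp‖ ^ 2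
      / (hρ.eigenvalues i + hρ.eigenvalues j) else 0

/-- The family of density matrices `ρ` is differentiable at the parameter value `ω`, and its quantum
Fisher information there is `F`. -/
def HasQFIAt (ρ : ℝ → Matrix n n ℂ) (ω F : ℝ) : Prop :=
  (∀ w, IsDensityMatrix (ρ w)) ∧
    ∃ (hρ : (ρ ω).IsHermitian) (ρ' : Matrix n n ℂ),
      (∀ a b, HasDerivAt (fun w => ρ w a b) (ρ' a b) ω) ∧ qfi (ρ ω) hρ ρ' = F

end Basic

end HiddenMarkovMetrology

end

/-! The span `S` contains the identity and is closed under adjoints, so `G ∉ S` gives a Hermitian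
`W` with `tr (W X) = 0` on `S` and `tr (W G) ≠ 0`. Since `tr W = 0`, the positive and negative parts
of `W` have a common trace `s > 0`. Divided by `s` they are two states with orthogonal supports that
agree on `S` and differ on `G`. Their purifications in an auxiliary space are the code words
(`exists_code`): orthogonality of the supports kills every off-diagonal element of `B ⊗ 1`, so each
`B ∈ S` acts on the code as a scalar, while `G` acts diagonally with two distinct eigenvalues.

As `S` contains the blocks of `H_EP`, of `L_k` and of the products `L_k† L_j`, the Knill–Laflamme
conditions hold for the blocks of the jump operators, and measuring the code followed by a recovery
corrects them (`exists_qecStep`). For a state supported on the code, applying the generator, tracing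
out the environment and correcting then leaves only `-iω[K, ·]`, with `K` the compression of `G`
(`map_traceEnv_lindbladian`). The coupling, the environment signal and the dissipators all cancel.

The environment keeps a nontrivial evolution of its own, but it need not be computed: each
functional `X ↦ ⟨C_i| Tr_E X |C_j⟩` is an eigenfunctional of the corrected generator with the
imaginary eigenvalue `-iω(λ_i - λ_j)`, and `tendsto_zeno` gives its limit directly. The limiting
state is pure with relative phase `ωt(λ₀ - λ₁)`, and its Fisher information follows by
differentiating `ρ² = ρ` (`qfi_eq_of_mul_add_mul`). -/

open scoped Kronecker Topology ComplexOrder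

noncomputable section

namespace HiddenMarkovMetrology

/-! ### Zeno limits along eigenfunctionals of the projected generator -/

section Zeno

variable {V : Type*} [NormedAddCommGroup V] [NormedSpace ℂ V] [FiniteDimensional ℂ V]

/-- A family of linear maps with pointwise derivative `L` at `0` has a uniform first-order
expansion. -/
theorem exists_uniform_expansion (S : ℝ → V →ₗ[ℂ] V) (L : V →ₗ[ℂ] V) (hS0 : ∀ x, S 0 x = x)
    (hS : ∀ x, HasDerivAt (fun τ => S τ x) (L x) 0) {ε : ℝ} (hε : 0 < ε) :
    ∀ᶠ τ in 𝓝 (0 : ℝ), ∀ x, ‖S τ x - x - τ • L x‖ ≤ ε * |τ| * ‖x‖ := by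
  classical
  set b := Module.finBasis ℂ V
  let c := fun i => LinearMap.toContinuousLinearMap (b.coord i)
  set K := ∑ i, ‖c i‖ with hK
  have hK0 : 0 ≤ K := Finset.sum_nonneg fun i _ => norm_nonneg _
  -- The remainder is linear in `x`, so finitely many bounds on a basis suffice. Dividing by `K + 1`
  -- rather than `K` avoids division by zero when `V` is trivial.
  have h1 : ∀ i, ∀ᶠ τ in 𝓝 (0 : ℝ), ‖S τ (b i) - b i - τ • L (b i)‖ ≤ ε / (K + 1) * |τ| := by
    intro i
    have := (hasDerivAt_iff_isLittleO_nhds_zero.1 (hS (b i))).def (c := ε / (K + 1)) (by positivity)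
    simpa [hS0] using this
  filter_upwards [Filter.eventually_all.2 h1] with τ hτ x
  have e : S τ x - x - τ • L x = ∑ i, (c i x) • (S τ (b i) - b i - τ • L (b i)) := by
    conv_lhs => rw [← b.sum_repr x]
    simp only [map_sum, map_smul, Finset.smul_sum, ← Finset.sum_sub_distrib, smul_sub]
    refine Finset.sum_congr rfl fun i _ => ?_
    rw [smul_comm]; rfl
  rw [e]
  calc _ ≤ ∑ i, ‖c i‖ * ‖x‖ * (ε / (K + 1) * |τ|) := by
        refine (norm_sum_le _ _).trans (Finset.sum_le_sum fun i _ => ?_)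
        rw [norm_smul]
        exact mul_le_mul ((c i).le_opNorm x) (hτ i) (norm_nonneg _) (by positivity)
    _ = (K / (K + 1)) * (ε * |τ| * ‖x‖) := by
        rw [← Finset.sum_mul, ← Finset.sum_mul, ← hK]; ring
    _ ≤ 1 * (ε * |τ| * ‖x‖) := by
        gcongr
        rw [div_le_one (by positivity)]; linarith
    _ = _ := one_mul _

/-- Quantum Zeno limit, seen by an eigenfunctional `f` of the projected generator whose eigenvalue
is purely imaginary. -/
theorem tendsto_zeno (D : V →ₗ[ℂ] V) (S : ℝ → V →ₗ[ℂ] V) (L : V →ₗ[ℂ] V) (f : V →ₗ[ℂ] ℂ) (θ : ℝ)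
    (hD : ∀ x, D (D x) = D x) (hS0 : ∀ x, S 0 x = x)
    (hS : ∀ x, HasDerivAt (fun τ => S τ x) (L x) 0)
    (hf : ∀ x, D x = x → f (D (L x)) = θ * Complex.I * f x) {x₀ : V} (hx₀ : D x₀ = x₀)
    {t : ℝ} (ht : 0 ≤ t) :
    Filter.Tendsto (fun N : ℕ => f ((fun x => D (S (t / N) x))^[N] x₀)) Filter.atTop
      (𝓝 (Complex.exp (t * θ * Complex.I) * f x₀)) := by
  let Dc := LinearMap.toContinuousLinearMap D
  let DLc := LinearMap.toContinuousLinearMap (D ∘ₗ L)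
  let fc := LinearMap.toContinuousLinearMap f
  have hDn : ∀ x, ‖D x‖ ≤ ‖Dc‖ * ‖x‖ := Dc.le_opNorm
  have hDLn : ∀ x, ‖D (L x)‖ ≤ ‖DLc‖ * ‖x‖ := DLc.le_opNorm
  have hfn : ∀ x, ‖f x‖ ≤ ‖fc‖ * ‖x‖ := fc.le_opNorm
  set p := ‖Dc‖
  set a := ‖DLc‖
  set q := ‖fc‖
  have hp : 0 ≤ p := norm_nonneg _
  have ha : 0 ≤ a := norm_nonneg _
  have hq : 0 ≤ q := norm_nonneg _
  set B := Real.exp (t * (a + p)) * ‖x₀‖ with hB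
  have hB0 : 0 ≤ B := by positivity
  have hcexp : ∀ ε : ℝ, 0 < ε → ∀ᶠ τ : ℝ in 𝓝 0,
      ‖Complex.exp (τ * θ * Complex.I) - 1 - τ * θ * Complex.I‖ ≤ ε * |τ| := by
    intro ε hε
    have h : HasDerivAt (fun τ : ℝ => Complex.exp (τ * θ * Complex.I)) (θ * Complex.I) 0 := by
      have := ((Complex.ofRealCLM.hasDerivAt (x := (0 : ℝ))).mul_const
        ((θ : ℂ) * Complex.I)).cexp
      simpa [mul_assoc] using this
    have := (hasDerivAt_iff_isLittleO_nhds_zero.1 h).def hε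
    simpa [mul_assoc] using this
  -- This form requires the estimate only for `N > N₀`, which makes `N` positive and `N * (t / N) =
  -- t` valid.
  rw [Metric.tendsto_atTop']
  intro δ hδ
  -- The factor of `ε` in the accumulated error; the added 1 keeps it positive when `t = 0`. The cap
  -- `ε ≤ 1` below makes the growth bound on the iterates independent of `ε`.
  set C := t * (q * (1 + p) * B) + 1 with hC
  have hC0 : 0 < C := by positivity
  set ε := min 1 (δ / (2 * C)) with hε
  have hε0 : 0 < ε := by positivity
  have hτ : Filter.Tendsto (fun N : ℕ => t / (N : ℝ)) Filter.atTop (𝓝 0) :=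
    tendsto_const_div_atTop_nhds_zero_nat t
  have hev := hτ.eventually ((exists_uniform_expansion S L hS0 hS hε0).and (hcexp ε hε0))
  obtain ⟨N₀, hN₀⟩ := Filter.eventually_atTop.1 hev
  refine ⟨N₀, fun N hN => ?_⟩
  obtain ⟨h1, h2⟩ := hN₀ N hN.le
  have hNpos : (0 : ℝ) < N := by exact_mod_cast (Nat.zero_le _).trans_lt hN
  set τ := t / N with hτdef
  have hτ0 : 0 ≤ τ := by positivity
  have hNτ : N * τ = t := by rw [hτdef]; field_simp
  rw [abs_of_nonneg hτ0] at h2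
  simp only [abs_of_nonneg hτ0] at h1
  set X : ℕ → V := fun k => (fun x => D (S τ x))^[k] x₀ with hX
  have hXs : ∀ k, X (k + 1) = D (S τ (X k)) := fun k => Function.iterate_succ_apply' _ _ _
  have hXD : ∀ k, D (X k) = X k := by
    intro k
    cases k with
    | zero => exact hx₀
    | succ k => rw [hXs, hD]
  have hstep : ∀ k, X (k + 1) =
      X k + τ • D (L (X k)) + D (S τ (X k) - X k - τ • L (X k)) := by
    intro k
    have : D (τ • L (X k)) = τ • D (L (X k)) := by
      rw [← Complex.coe_smul, map_smul, Complex.coe_smul]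
    rw [hXs, map_sub, map_sub, this, hXD]
    abel
  have hrem : ∀ k, ‖D (S τ (X k) - X k - τ • L (X k))‖ ≤ p * (ε * τ * ‖X k‖) := fun k =>
    (hDn _).trans (by gcongr; exact h1 _)
  have hnorm1 : ∀ k, ‖X (k + 1)‖ ≤ Real.exp (τ * (a + p)) * ‖X k‖ := by
    intro k
    have hε1 : ε ≤ 1 := min_le_left _ _
    calc ‖X (k + 1)‖ ≤ ‖X k‖ + τ * (a * ‖X k‖) + p * (1 * τ * ‖X k‖) := by
          rw [hstep]
          refine (norm_add₃_le).trans ?_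
          gcongr
          · rw [norm_smul, Real.norm_of_nonneg hτ0]
            gcongr
            exact hDLn _
          · exact (hrem k).trans (by gcongr)
      _ = (τ * (a + p) + 1) * ‖X k‖ := by ring
      _ ≤ _ := by gcongr; exact Real.add_one_le_exp _
  have hnorm : ∀ k, ‖X k‖ ≤ Real.exp (k * (τ * (a + p))) * ‖x₀‖ := by
    intro k
    induction k with
    | zero => simp [hX]
    | succ k ih =>
      calc _ ≤ _ := hnorm1 k
        _ ≤ Real.exp (τ * (a + p)) * (Real.exp (k * (τ * (a + p))) * ‖x₀‖) := by gcongr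
        _ = _ := by
          rw [← mul_assoc, ← Real.exp_add]
          congr 2
          push_cast; ring
  have hnormB : ∀ k ≤ N, ‖X k‖ ≤ B := by
    intro k hk
    refine (hnorm k).trans ?_
    have : (k : ℝ) * τ ≤ t := by rw [← hNτ]; gcongr
    rw [hB, ← mul_assoc]
    gcongr
  -- The eigenfunctional property matches the first-order term of the exponential, so only the two
  -- remainders are left.
  have herr : ∀ k < N, ‖f (X (k + 1)) - Complex.exp (τ * θ * Complex.I) * f (X k)‖
      ≤ ε * τ * (q * (1 + p) * B) := by
    intro k hk
    have e : f (X (k + 1)) - Complex.exp (τ * θ * Complex.I) * f (X k) =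
        -((Complex.exp (τ * θ * Complex.I) - 1 - τ * θ * Complex.I) * f (X k))
          + f (D (S τ (X k) - X k - τ • L (X k))) := by
      rw [hstep, map_add, map_add, ← Complex.coe_smul, map_smul, hf _ (hXD k), smul_eq_mul]
      ring
    have hb := hnormB k hk.le
    calc _ ≤ (ε * τ) * (q * B) + q * (p * (ε * τ * B)) := by
          rw [e]
          refine (norm_add_le _ _).trans ?_
          rw [norm_neg, norm_mul]
          gcongr
          · exact (hfn _).trans (by gcongr)
          · refine (hfn _).trans ?_
            gcongr
            exact (hrem k).trans (by gcongr)
      _ = _ := by ring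
  have hexp : ‖Complex.exp (τ * θ * Complex.I)‖ = 1 := by
    have := Complex.norm_exp_ofReal_mul_I (τ * θ)
    push_cast at this
    exact this
  -- The exponential factor has modulus one because the eigenvalue is imaginary. Earlier errors are
  -- therefore not amplified, and `N` errors of size `ετ` add up to order `εt`.
  have htot : ∀ k ≤ N, ‖f (X k) - Complex.exp (τ * θ * Complex.I) ^ k * f x₀‖
      ≤ k * (ε * τ * (q * (1 + p) * B)) := by
    intro k
    induction k with
    | zero => intro _; simp [hX]
    | succ k ih =>
      intro hk
      have e : f (X (k + 1)) - Complex.exp (τ * θ * Complex.I) ^ (k + 1) * f x₀ =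
          (f (X (k + 1)) - Complex.exp (τ * θ * Complex.I) * f (X k))
          + Complex.exp (τ * θ * Complex.I) *
            (f (X k) - Complex.exp (τ * θ * Complex.I) ^ k * f x₀) := by ring
      rw [e]
      refine (norm_add_le _ _).trans ?_
      rw [norm_mul, hexp, one_mul]
      have := herr k hk
      have := ih (by omega)
      push_cast
      linarith
  have hfin := htot N le_rfl
  rw [← Complex.exp_nat_mul] at hfin
  have e1 : (N : ℂ) * (τ * θ * Complex.I) = t * θ * Complex.I := by
    rw [← hNτ]; push_cast; ring
  rw [e1] at hfin
  rw [dist_eq_norm]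
  calc _ ≤ _ := hfin
    _ = ε * (t * (q * (1 + p) * B)) := by rw [← hNτ]; ring
    _ ≤ (δ / (2 * C)) * C := by
        gcongr
        · exact min_le_right _ _
        · rw [hC]; linarith
    _ = δ / 2 := by field_simp
    _ < δ := by linarith

end Zeno

/-! ### Knill–Laflamme error correction -/

section Recovery

variable {n κ : Type*} [Fintype n]

theorem star_dotProduct_mulVec (A B : Matrix n n ℂ) (u v : n → ℂ) :
    star (A.mulVec u) ⬝ᵥ B.mulVec v = star u ⬝ᵥ (A.conjTranspose * B).mulVec v := by
  rw [Matrix.star_mulVec, ← Matrix.dotProduct_mulVec, Matrix.mulVec_mulVec]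

/-- The Knill–Laflamme conditions extend from a family of errors to its span. -/
theorem knillLaflamme_span {α : Type*} (Q : Matrix n n ℂ) (F : α → Matrix n n ℂ)
    (h : ∀ a b, ∃ c : ℂ, Q * (F a).conjTranspose * F b * Q = c • Q)
    {X Y : Matrix n n ℂ} (hX : X ∈ Submodule.span ℂ (Set.range F))
    (hY : Y ∈ Submodule.span ℂ (Set.range F)) :
    ∃ c : ℂ, Q * X.conjTranspose * Y * Q = c • Q := by
  induction hX using Submodule.span_induction with
  | mem x hx =>
    obtain ⟨a, rfl⟩ := hx
    induction hY using Submodule.span_induction with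
    | mem y hy => obtain ⟨b, rfl⟩ := hy; exact h a b
    | zero => exact ⟨0, by simp⟩
    | add y z _ _ hy hz =>
      obtain ⟨c, hc⟩ := hy
      obtain ⟨d, hd⟩ := hz
      exact ⟨c + d, by rw [mul_add, add_mul, hc, hd, add_smul]⟩
    | smul r y _ hy =>
      obtain ⟨c, hc⟩ := hy
      exact ⟨r * c, by rw [mul_smul_comm, smul_mul_assoc, hc, smul_smul]⟩
  | zero => exact ⟨0, by simp⟩
  | add y z _ _ hy hz =>
    obtain ⟨c, hc⟩ := hy
    obtain ⟨d, hd⟩ := hz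
    exact ⟨c + d, by rw [Matrix.conjTranspose_add, mul_add, add_mul, add_mul, hc, hd, add_smul]⟩
  | smul r y _ hy =>
    obtain ⟨c, hc⟩ := hy
    exact ⟨star r * c, by
      rw [Matrix.conjTranspose_smul, mul_smul_comm, smul_mul_assoc, smul_mul_assoc, hc, smul_smul]⟩

/-- The span of errors satisfying the Knill–Laflamme conditions is spanned, on the code space, by
errors which map the code space isometrically to orthogonal subspaces. -/
theorem exists_orthonormal_errors {α : Type*} (Q : Matrix n n ℂ) (hQh : Q.conjTranspose = Q)
    {u : n → ℂ} (hu : Q.mulVec u = u) (hu1 : star u ⬝ᵥ u = 1) (F : α → Matrix n n ℂ)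
    (h : ∀ a b, ∃ c : ℂ, Q * (F a).conjTranspose * F b * Q = c • Q) :
    ∃ (m : ℕ) (W : Fin m → Matrix n n ℂ),
      (∀ k l, Q * (W k).conjTranspose * W l * Q = if k = l then Q else 0) ∧
      ∀ a, ∃ s : Fin m → ℂ, F a * Q = ∑ k, s k • (W k * Q) := by
  classical
  set 𝒱 := Submodule.span ℂ (Set.range F) with h𝒱
  -- The Knill–Laflamme constant of `X` and `Y` is the inner product of `X u` and `Y u`, so one unit
  -- code vector `u` sees the whole Gram form. The `W k` are lifts of an orthonormal basis of the
  -- image.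
  let ev : Matrix n n ℂ →ₗ[ℂ] EuclideanSpace ℂ n :=
    { toFun := fun X => WithLp.toLp 2 (X.mulVec u)
      map_add' := by intro X Y; rw [Matrix.add_mulVec]; rfl
      map_smul' := by intro c X; rw [Matrix.smul_mulVec]; rfl }
  set b := stdOrthonormalBasis ℂ (𝒱.map ev)
  have hW : ∀ k, ∃ X ∈ 𝒱, ev X = (b k : EuclideanSpace ℂ n) := fun k => (b k).2
  choose W hW𝒱 hWb using hW
  have hinner : ∀ X Y : Matrix n n ℂ, inner ℂ (ev X) (ev Y) =
      star u ⬝ᵥ (X.conjTranspose * Y).mulVec u := by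
    intro X Y
    rw [← star_dotProduct_mulVec, EuclideanSpace.inner_eq_star_dotProduct, dotProduct_comm]
    rfl
  have hc : ∀ X Y : Matrix n n ℂ, X ∈ 𝒱 → Y ∈ 𝒱 →
      Q * X.conjTranspose * Y * Q = (inner ℂ (ev X) (ev Y)) • Q := by
    intro X Y hX hY
    obtain ⟨c, hc⟩ := knillLaflamme_span Q F h hX hY
    have h1 : star u ⬝ᵥ (Q * X.conjTranspose * Y * Q).mulVec u =
        star u ⬝ᵥ (X.conjTranspose * Y).mulVec u := by
      have e : Q * X.conjTranspose * Y * Q = Q.conjTranspose * (X.conjTranspose * Y * Q) := by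
        rw [hQh]; simp only [mul_assoc]
      rw [e, ← star_dotProduct_mulVec, hu, ← Matrix.mulVec_mulVec, hu]
    rw [hc, Matrix.smul_mulVec, hu, dotProduct_smul, hu1, smul_eq_mul, mul_one] at h1
    rw [hc, hinner, h1]
  refine ⟨_, W, fun k l => ?_, fun a => ?_⟩
  · rw [hc _ _ (hW𝒱 k) (hW𝒱 l), hWb, hWb, ← Submodule.coe_inner,
      orthonormal_iff_ite.1 b.orthonormal]
    split_ifs <;> simp
  · have hFa : F a ∈ 𝒱 := Submodule.subset_span ⟨a, rfl⟩
    set x : 𝒱.map ev := ⟨ev (F a), Submodule.mem_map_of_mem hFa⟩ with hx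
    refine ⟨fun k => b.repr x k, ?_⟩
    set Y := F a - ∑ k, b.repr x k • W k with hY
    have hYm : Y ∈ 𝒱 := 𝒱.sub_mem hFa (𝒱.sum_mem fun k _ => 𝒱.smul_mem _ (hW𝒱 k))
    have hY0 : ev Y = 0 := by
      have := congrArg (Subtype.val) (b.sum_repr x)
      simp only [AddSubmonoidClass.coe_finsetSum, Submodule.coe_smul, ← hWb, hx] at this
      rw [hY, map_sub, map_sum, sub_eq_zero]
      simp only [map_smul]
      exact this.symm
    -- An error in the span that kills `u` kills the whole code, since `(Y Q)† (Y Q)` is the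
    -- multiple `‖Y u‖²` of `Q`.
    have h0 := hc Y Y hYm hYm
    rw [hY0, inner_zero_left, zero_smul] at h0
    have h1 : Y * Q = 0 := by
      rw [← Matrix.conjTranspose_mul_self_eq_zero, Matrix.conjTranspose_mul, hQh, ← h0]
      simp only [mul_assoc]
    rw [hY, sub_mul, sub_eq_zero, Finset.sum_mul] at h1
    rw [h1]
    simp only [smul_mul_assoc]

variable [DecidableEq n] [Fintype κ]

/-- The superoperator with Kraus operators `K i`. -/
def krausMap (K : κ → Matrix n n ℂ) : Matrix n n ℂ →ₗ[ℂ] Matrix n n ℂ :=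
  ∑ i, LinearMap.mulLeft ℂ (K i) ∘ₗ LinearMap.mulRight ℂ (K i).conjTranspose

theorem krausMap_apply (K : κ → Matrix n n ℂ) (X : Matrix n n ℂ) :
    krausMap K X = ∑ i, K i * X * (K i).conjTranspose := by
  simp [krausMap, LinearMap.sum_apply, mul_assoc]

theorem onSecond_krausMap {F : Type*} [Fintype F] [DecidableEq F] (K : κ → Matrix n n ℂ)
    (X : Matrix (F × n) (F × n) ℂ) :
    onSecond F (krausMap K) X =
      ∑ i, ((1 : Matrix F F ℂ) ⊗ₖ K i) * X * ((1 : Matrix F F ℂ) ⊗ₖ K i).conjTranspose := by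
  ext ⟨e, a⟩ ⟨e', b⟩
  simp only [onSecond, Matrix.of_apply, krausMap_apply, Matrix.sum_apply]
  refine Finset.sum_congr rfl fun i _ => ?_
  simp only [Matrix.mul_apply, Fintype.sum_prod_type, Matrix.kroneckerMap_apply, Matrix.of_apply,
    Matrix.conjTranspose_apply, Matrix.one_apply]
  simp [apply_ite, ite_mul, Finset.sum_ite_irrel]

theorem isCPTP_krausMap (K : κ → Matrix n n ℂ) (hK : ∑ i, (K i).conjTranspose * K i = 1) :
    IsCPTP (krausMap K) := by
  refine ⟨fun d X hX => ?_, fun X => ?_⟩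
  · rw [onSecond_krausMap]
    exact Matrix.posSemidef_sum _ fun i _ => hX.mul_mul_conjTranspose_same _
  · rw [krausMap_apply, Matrix.trace_sum]
    simp_rw [fun i => Matrix.trace_mul_cycle (K i) X (K i).conjTranspose]
    rw [← Matrix.trace_sum, ← Finset.sum_mul, hK, one_mul]

/-- Knill–Laflamme: errors satisfying the Knill–Laflamme conditions are corrected by a recovery. -/
theorem exists_recovery {α : Type*} (Q : Matrix n n ℂ) (hQh : Q.conjTranspose = Q)
    (hQQ : Q * Q = Q) {u : n → ℂ} (hu : Q.mulVec u = u) (hu1 : star u ⬝ᵥ u = 1)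
    (F : α → Matrix n n ℂ)
    (h : ∀ a b, ∃ c : ℂ, Q * (F a).conjTranspose * F b * Q = c • Q) :
    ∃ R : Matrix n n ℂ →ₗ[ℂ] Matrix n n ℂ, IsRecovery Q R ∧
      ∀ a b, ∃ c : ℂ, ∀ C, Q * C * Q = C → R (F a * C * (F b).conjTranspose) = c • C := by
  obtain ⟨m, W, hW, hF⟩ := exists_orthonormal_errors Q hQh hu hu1 F h
  -- The projector onto the complement of the mutually orthogonal images of the code under the `W
  -- k`.
  set T : Matrix n n ℂ := 1 - ∑ k, W k * Q * (W k).conjTranspose with hT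
  have hTh : T.conjTranspose = T := by
    simp only [hT, Matrix.conjTranspose_sub, Matrix.conjTranspose_one, Matrix.conjTranspose_sum,
      Matrix.conjTranspose_mul, hQh, Matrix.conjTranspose_conjTranspose, mul_assoc]
  have hTW : ∀ l, T * (W l * Q) = 0 := by
    intro l
    rw [hT, sub_mul, one_mul, Finset.sum_mul, sub_eq_zero]
    have : ∀ k, W k * Q * (W k).conjTranspose * (W l * Q) = W k * if k = l then Q else 0 := by
      intro k
      rw [← hW k l]
      simp only [mul_assoc]
    simp [this]
  have hTT : T * T = T := by
    have : ∀ k, T * (W k * Q * (W k).conjTranspose) = 0 := fun k => by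
      rw [← mul_assoc, hTW, zero_mul]
    nth_rewrite 2 [hT]
    rw [mul_sub, mul_one, Finset.mul_sum]
    simp [this]
  -- The first family undoes each orthogonal error. The second sends whatever lies outside all error
  -- spaces to `u`, which makes the map trace preserving while its outputs stay in the code.
  let K : Fin m ⊕ n → Matrix n n ℂ :=
    Sum.elim (fun k => Q * (W k).conjTranspose)
      (fun j => Matrix.vecMulVec u (Pi.single j 1) * T)
  have hQK : ∀ i, Q * K i = K i := by
    rintro (k | j)
    · simp only [K, Sum.elim_inl, ← mul_assoc, hQQ]
    · simp only [K, Sum.elim_inr, ← mul_assoc, Matrix.mul_vecMulVec, hu]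
  refine ⟨krausMap K, ⟨isCPTP_krausMap K ?_, fun X => ?_⟩, fun a b => ?_⟩
  · have h1 : ∀ j : n, (Matrix.vecMulVec u (Pi.single j 1) * T).conjTranspose *
        (Matrix.vecMulVec u (Pi.single j 1) * T) =
        T * Matrix.vecMulVec (Pi.single j 1) (Pi.single j 1) * T := by
      intro j
      have : (Matrix.vecMulVec u (Pi.single j (1 : ℂ))).conjTranspose *
          Matrix.vecMulVec u (Pi.single j 1) =
          Matrix.vecMulVec (Pi.single j 1) (Pi.single j 1) := by
        rw [Matrix.conjTranspose_vecMulVec, Matrix.vecMulVec_mul_vecMulVec, hu1]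
        simp
      rw [Matrix.conjTranspose_mul, hTh, mul_assoc, ← mul_assoc _ _ T, this, mul_assoc]
    have h2 : ∑ j : n, Matrix.vecMulVec (Pi.single j (1 : ℂ)) (Pi.single j 1)
        = (1 : Matrix n n ℂ) := by
      ext a b
      simp [Matrix.sum_apply, Matrix.vecMulVec_apply, Pi.single_apply, Matrix.one_apply]
    rw [Fintype.sum_sum_type]
    simp only [K, Sum.elim_inl, Sum.elim_inr, h1]
    rw [← Finset.sum_mul, ← Finset.mul_sum, h2, mul_one, hTT, hT]
    simp only [Matrix.conjTranspose_mul, hQh, Matrix.conjTranspose_conjTranspose]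
    have : ∀ k, W k * Q * (Q * (W k).conjTranspose) = W k * Q * (W k).conjTranspose := fun k => by
      rw [← mul_assoc, mul_assoc (W k), hQQ]
    simp [this]
  · rw [krausMap_apply, Finset.mul_sum, Finset.sum_mul]
    refine Finset.sum_congr rfl fun i _ => ?_
    have : (K i).conjTranspose * Q = (K i).conjTranspose := by
      conv_rhs => rw [← hQK i, Matrix.conjTranspose_mul, hQh]
    rw [mul_assoc, mul_assoc, this, ← mul_assoc, ← mul_assoc, hQK]
  · obtain ⟨s, hs⟩ := hF a
    obtain ⟨s', hs'⟩ := hF b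
    have hK1 : ∀ (a : α) (s : Fin m → ℂ), F a * Q = ∑ k, s k • (W k * Q) →
        ∀ k, K (Sum.inl k) * (F a * Q) = s k • Q := by
      intro a s hs k
      simp only [K, Sum.elim_inl]
      rw [hs, Finset.mul_sum]
      have : ∀ l, Q * (W k).conjTranspose * (s l • (W l * Q)) = if k = l then s l • Q else 0 := by
        intro l
        rw [mul_smul_comm, ← mul_assoc, hW]
        split_ifs <;> simp
      simp [this]
    have hK2 : ∀ (a : α) (s : Fin m → ℂ), F a * Q = ∑ k, s k • (W k * Q) →
        ∀ j, K (Sum.inr j) * (F a * Q) = 0 := by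
      intro a s hs j
      simp only [K, Sum.elim_inr]
      rw [hs, Finset.mul_sum]
      refine Finset.sum_eq_zero fun l _ => ?_
      rw [mul_smul_comm, mul_assoc, hTW, mul_zero, smul_zero]
    refine ⟨∑ k, s k * star (s' k), fun C hC => ?_⟩
    have e : ∀ i, K i * (F a * C * (F b).conjTranspose) * (K i).conjTranspose =
        (K i * (F a * Q)) * C * (K i * (F b * Q)).conjTranspose := by
      intro i
      conv_lhs => rw [← hC]
      simp only [Matrix.conjTranspose_mul, hQh, mul_assoc]
    rw [krausMap_apply, Fintype.sum_sum_type]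
    simp only [e, hK1 a s hs, hK1 b s' hs', hK2 a s hs, zero_mul, Finset.sum_const_zero, add_zero,
      Matrix.conjTranspose_smul, hQh, smul_mul_assoc, mul_smul_comm, hC, smul_smul]
    rw [← Finset.sum_smul]
    simp only [mul_comm]

end Recovery

/-! ### Construction of the code from a separating Hermitian matrix -/

section Code

variable {P : Type*} [Fintype P]

/-- A lifted operator leaves the auxiliary label of each `v k` untouched, so only terms with equal
labels survive. The overlap is governed by the products `w k * w' k` alone, hence vanishes for
disjoint weights. -/
theorem star_dotProduct_liftP_mulVec {A : Type*} [Fintype A] [DecidableEq A] (e : P ≃ A)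
    (v : OrthonormalBasis P ℂ (EuclideanSpace ℂ P)) (w w' : P → ℝ) (B : Matrix P P ℂ) :
    star (fun x : P × A => (w (e.symm x.2) : ℂ) * v (e.symm x.2) x.1) ⬝ᵥ
      (liftP A B).mulVec (fun x : P × A => (w' (e.symm x.2) : ℂ) * v (e.symm x.2) x.1) =
    ∑ k, ((w k * w' k : ℝ) : ℂ) * (star (v k).ofLp ⬝ᵥ B.mulVec (v k).ofLp) := by
  simp only [dotProduct, Matrix.mulVec, liftP, Fintype.sum_prod_type, Matrix.kroneckerMap_apply,
    Matrix.one_apply, Pi.star_apply, star_mul']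
  rw [Finset.sum_comm, ← e.sum_comp]
  refine Finset.sum_congr rfl fun k _ => ?_
  rw [Finset.mul_sum]
  refine Finset.sum_congr rfl fun p _ => ?_
  simp only [mul_ite, mul_one, mul_zero, ite_mul, zero_mul, Finset.sum_ite_eq, Finset.mem_univ,
    if_true, Equiv.symm_apply_apply, Finset.mul_sum]
  refine Finset.sum_congr rfl fun q _ => ?_
  simp
  ring

variable [DecidableEq P]

theorem exists_trace_functional (f : Matrix P P ℂ →ₗ[ℂ] ℂ) :
    ∃ W : Matrix P P ℂ, ∀ X, f X = (W * X).trace := by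
  refine ⟨Matrix.of fun a b => f (Matrix.single b a 1), fun X => ?_⟩
  conv_lhs => rw [Matrix.matrix_eq_sum_single X]
  simp only [map_sum, Matrix.trace, Matrix.diag_apply, Matrix.mul_apply, Matrix.of_apply]
  rw [Finset.sum_comm]
  refine Finset.sum_congr rfl fun a _ => Finset.sum_congr rfl fun b _ => ?_
  have : Matrix.single b a (X b a) = X b a • Matrix.single b a (1 : ℂ) := by simp
  rw [this, map_smul, smul_eq_mul, mul_comm]

/-- A Hermitian matrix outside a self-adjoint subspace is separated from it by a Hermitian
matrix. -/
theorem exists_isHermitian_separating (S : Submodule ℂ (Matrix P P ℂ))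
    (hS : ∀ X ∈ S, X.conjTranspose ∈ S) {G : Matrix P P ℂ} (hG : G ∉ S) :
    ∃ W : Matrix P P ℂ, W.IsHermitian ∧ (∀ X ∈ S, (W * X).trace = 0) ∧ (W * G).trace ≠ 0 := by
  obtain ⟨f, hfG, hfS⟩ := Submodule.exists_le_ker_of_notMem hG
  obtain ⟨W, hW⟩ := exists_trace_functional f
  have h0 : ∀ X ∈ S, (W * X).trace = 0 := fun X hX => by rw [← hW]; exact hfS hX
  have h0' : ∀ X ∈ S, (W.conjTranspose * X).trace = 0 := fun X hX => by
    have := h0 _ (hS X hX)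
    rw [Matrix.trace_mul_comm, ← Matrix.conjTranspose_conjTranspose X,
      ← Matrix.conjTranspose_mul, Matrix.trace_conjTranspose, this, star_zero]
  -- Both Hermitian combinations of `W` annihilate `S`. They cannot both annihilate `G`, since `W`
  -- is a combination of them.
  by_cases h : ((W + W.conjTranspose) * G).trace = 0
  · refine ⟨Complex.I • (W - W.conjTranspose), ?_, fun X hX => ?_, fun h' => ?_⟩
    · rw [Matrix.IsHermitian, Matrix.conjTranspose_smul, Matrix.conjTranspose_sub,
        Matrix.conjTranspose_conjTranspose]
      simp [smul_sub, neg_add_eq_sub]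
    · rw [smul_mul_assoc, Matrix.trace_smul, sub_mul, Matrix.trace_sub, h0 X hX, h0' X hX]
      simp
    · rw [smul_mul_assoc, Matrix.trace_smul, sub_mul, Matrix.trace_sub, smul_eq_mul] at h'
      rw [add_mul, Matrix.trace_add] at h
      have h'' := (mul_eq_zero.1 h').resolve_left Complex.I_ne_zero
      apply hfG
      rw [hW]
      linear_combination (h + h'') / 2
  · refine ⟨W + W.conjTranspose, ?_, fun X hX => ?_, h⟩
    · rw [Matrix.IsHermitian, Matrix.conjTranspose_add, Matrix.conjTranspose_conjTranspose,
        add_comm]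
    · rw [add_mul, Matrix.trace_add, h0 X hX, h0' X hX, add_zero]

/-- Trace against a Hermitian matrix, in an eigenbasis. -/
theorem trace_mul_eq_sum_eigenvalues {W : Matrix P P ℂ} (hW : W.IsHermitian) (X : Matrix P P ℂ) :
    (W * X).trace = ∑ k, (hW.eigenvalues k : ℂ) *
      (star (hW.eigenvectorBasis k).ofLp ⬝ᵥ X.mulVec (hW.eigenvectorBasis k).ofLp) := by
  set U : Matrix P P ℂ := (hW.eigenvectorUnitary : Matrix P P ℂ) with hU
  have hUU : U * star U = 1 := Unitary.mul_star_self_of_mem hW.eigenvectorUnitary.2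
  have h1 : (W * X).trace = (star U * (X * W) * U).trace := by
    rw [Matrix.trace_mul_cycle, hUU, one_mul, Matrix.trace_mul_comm]
  rw [h1, Matrix.trace]
  refine Finset.sum_congr rfl fun k _ => ?_
  have h2 : (star U * (X * W) * U) k k =
      star (hW.eigenvectorBasis k).ofLp ⬝ᵥ (X * W).mulVec (hW.eigenvectorBasis k).ofLp := by
    rw [mul_assoc, Matrix.mul_apply]
    simp only [dotProduct, Matrix.mulVec, Matrix.mul_apply (M := X * W)]
    rfl
  rw [Matrix.diag_apply, h2, ← Matrix.mulVec_mulVec, hW.mulVec_eigenvectorBasis,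
    Matrix.mulVec_smul, dotProduct_smul]
  simp

/-- A code which does not see a self-adjoint subspace `S` containing `1`, but sees a Hermitian
matrix outside of `S`. -/
theorem exists_code (S : Submodule ℂ (Matrix P P ℂ)) (hS1 : 1 ∈ S)
    (hS : ∀ X ∈ S, X.conjTranspose ∈ S) {G : Matrix P P ℂ} (hGh : G.IsHermitian) (hG : G ∉ S) :
    ∃ (dA : ℕ) (C : Fin 2 → P × Fin dA → ℂ) (lam : Fin 2 → ℝ),
      (∀ i j, star (C i) ⬝ᵥ C j = if i = j then 1 else 0) ∧ lam 0 ≠ lam 1 ∧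
      (∀ B ∈ S, ∃ c : ℂ, ∀ i j,
        star (C i) ⬝ᵥ (liftP (Fin dA) B).mulVec (C j) = if i = j then c else 0) ∧
      ∀ i j, star (C i) ⬝ᵥ (liftP (Fin dA) G).mulVec (C j) =
        if i = j then (lam i : ℂ) else 0 := by
  obtain ⟨W, hW, hWS, hWG⟩ := exists_isHermitian_separating S hS hG
  set v := hW.eigenvectorBasis with hv
  set g := hW.eigenvalues with hg
  have hvv : ∀ k, star (v k).ofLp ⬝ᵥ (v k).ofLp = 1 := by
    intro k
    have := orthonormal_iff_ite.1 v.orthonormal k k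
    rw [EuclideanSpace.inner_eq_star_dotProduct, dotProduct_comm] at this
    simpa using this
  have hg0 : ∑ k, g k = 0 := by
    have := hWS 1 hS1
    rw [trace_mul_eq_sum_eigenvalues hW] at this
    simp only [Matrix.one_mulVec, ← hv, hvv, mul_one] at this
    exact_mod_cast this
  -- The trace of the positive part of `W`. It equals that of the negative part because `1 ∈ S`
  -- forces `tr W = 0`; were it zero, every eigenvalue would vanish and `tr (W G)` with them.
  set s := ∑ k, max (g k) 0 with hs
  have hpm : ∀ k, max (g k) 0 - max (-g k) 0 = g k := fun k => by
    rcases le_total (g k) 0 with h | h <;> simp [h]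
  have hs' : s = ∑ k, max (-g k) 0 := by
    rw [← sub_eq_zero, hs, ← Finset.sum_sub_distrib]
    simp [hpm, hg0]
  have hs0 : 0 ≤ s := Finset.sum_nonneg fun k _ => le_max_right _ _
  have hspos : 0 < s := by
    refine lt_of_le_of_ne hs0 fun h => hWG ?_
    have h1 := (Finset.sum_eq_zero_iff_of_nonneg fun k _ => le_max_right (g k) 0).1 h.symm
    have h2 := (Finset.sum_eq_zero_iff_of_nonneg fun k _ => le_max_right (-g k) 0).1
      (hs' ▸ h.symm)
    rw [trace_mul_eq_sum_eigenvalues hW]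
    refine Finset.sum_eq_zero fun k hk => ?_
    have := hpm k
    rw [h1 k hk, h2 k hk] at this
    rw [← hg, ← this]
    simp
  -- Square roots of the eigenvalues of the normalized positive (`i = 0`) and negative (`i = 1`)
  -- parts of `W`, used as Schmidt coefficients of the code words.
  let w : Fin 2 → P → ℝ := fun i k =>
    Real.sqrt (max ((if i = 0 then 1 else -1) * g k) 0 / s)
  have hww : ∀ i k, w i k * w i k = max ((if i = 0 then 1 else -1) * g k) 0 / s := fun i k =>
    Real.mul_self_sqrt (by positivity)
  have hw01 : ∀ k, w 0 k * w 1 k = 0 := by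
    intro k
    simp only [w]
    rcases le_total (g k) 0 with h | h <;> simp [h]
  have hwij : ∀ i j, i ≠ j → ∀ k, w i k * w j k = 0 := by
    intro i j hij k
    have : (i = 0 ∧ j = 1) ∨ (i = 1 ∧ j = 0) := by omega
    rcases this with ⟨rfl, rfl⟩ | ⟨rfl, rfl⟩
    · exact hw01 k
    · rw [mul_comm]; exact hw01 k
  let e := Fintype.equivFin P
  let C : Fin 2 → P × Fin (Fintype.card P) → ℂ := fun i x =>
    (w i (e.symm x.2) : ℂ) * v (e.symm x.2) x.1
  have hC : ∀ i j B, star (C i) ⬝ᵥ (liftP (Fin (Fintype.card P)) B).mulVec (C j) =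
      ∑ k, ((w i k * w j k : ℝ) : ℂ) * (star (v k).ofLp ⬝ᵥ B.mulVec (v k).ofLp) :=
    fun i j B => star_dotProduct_liftP_mulVec e v (w i) (w j) B
  have hCne : ∀ i j, i ≠ j → ∀ B,
      star (C i) ⬝ᵥ (liftP (Fin (Fintype.card P)) B).mulVec (C j) = 0 := by
    intro i j hij B
    rw [hC]
    simp [hwij i j hij]
  -- The code words disagree about `B` exactly by `tr (W B) / s`: zero on `S`, nonzero for `G`.
  have hCdiff : ∀ B, star (C 0) ⬝ᵥ (liftP (Fin (Fintype.card P)) B).mulVec (C 0)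
      - star (C 1) ⬝ᵥ (liftP (Fin (Fintype.card P)) B).mulVec (C 1) = (W * B).trace / s := by
    intro B
    rw [hC, hC, ← Finset.sum_sub_distrib, trace_mul_eq_sum_eigenvalues hW, Finset.sum_div]
    refine Finset.sum_congr rfl fun k _ => ?_
    rw [hww, hww, ← sub_mul, ← Complex.ofReal_sub, ← sub_div]
    simp only [if_true, one_mul, one_ne_zero, if_false, neg_mul, hpm]
    push_cast
    ring
  have hC1 : ∀ i j, star (C i) ⬝ᵥ C j = if i = j then 1 else 0 := by
    intro i j
    have e1 : liftP (Fin (Fintype.card P)) (1 : Matrix P P ℂ) = 1 := by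
      rw [liftP, Matrix.one_kronecker_one]
    have e2 := hC i j 1
    rw [e1, Matrix.one_mulVec] at e2
    rw [e2]
    split_ifs with h
    · subst h
      simp only [Matrix.one_mulVec, hvv, mul_one]
      norm_cast
      simp only [hww, ← Finset.sum_div]
      have : ∑ k, max ((if i = 0 then 1 else -1) * g k) 0 = s := by
        fin_cases i
        · simp [hs]
        · simp [hs']
      rw [this, div_self hspos.ne']
    · simp [hwij i j h]
  have hreal : ∀ i, star (star (C i) ⬝ᵥ (liftP (Fin (Fintype.card P)) G).mulVec (C i)) =
      star (C i) ⬝ᵥ (liftP (Fin (Fintype.card P)) G).mulVec (C i) := by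
    intro i
    have hh : (liftP (Fin (Fintype.card P)) G).conjTranspose = liftP (Fin (Fintype.card P)) G := by
      rw [liftP, Matrix.conjTranspose_kronecker, hGh, Matrix.conjTranspose_one]
    rw [← Matrix.star_dotProduct_star, star_star, Matrix.star_mulVec, hh,
      Matrix.dotProduct_mulVec]
  have hreal' : ∀ i, ((star (C i) ⬝ᵥ (liftP (Fin (Fintype.card P)) G).mulVec (C i)).re : ℂ) =
      star (C i) ⬝ᵥ (liftP (Fin (Fintype.card P)) G).mulVec (C i) := fun i =>
    Complex.conj_eq_iff_re.1 (hreal i)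
  refine ⟨Fintype.card P, C, fun i => (star (C i) ⬝ᵥ (liftP _ G).mulVec (C i)).re, hC1,
    fun h => ?_, fun B hB => ?_, fun i j => ?_⟩
  · have h1 := hCdiff G
    beta_reduce at h
    rw [← hreal' 0, ← hreal' 1, h, sub_self] at h1
    rcases div_eq_zero_iff.1 h1.symm with h2 | h2
    · exact hWG h2
    · exact hspos.ne' (by exact_mod_cast h2)
  · refine ⟨star (C 0) ⬝ᵥ (liftP _ B).mulVec (C 0), fun i j => ?_⟩
    have h1 := hCdiff B
    rw [hWS B hB, zero_div, sub_eq_zero] at h1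
    split_ifs with h
    · subst h
      fin_cases i
      · rfl
      · exact h1.symm
    · exact hCne i j h B
  · split_ifs with h
    · subst h
      exact (hreal' i).symm
    · exact hCne i j h G

end Code

/-! ### Environment blocks and the partial trace -/

section Blocks

variable {E P A n : Type*}

/-- The block `⟨e| X |e'⟩` in the standard basis of the first factor. -/
def blk (X : Matrix (E × n) (E × n) ℂ) (e e' : E) : Matrix n n ℂ :=
  Matrix.of fun a b => X (e, a) (e', b)

theorem blk_conjTranspose (X : Matrix (E × n) (E × n) ℂ) (e e' : E) :
    blk X.conjTranspose e e' = (blk X e' e).conjTranspose := rfl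

theorem blk_onSecond (D : Matrix n n ℂ →ₗ[ℂ] Matrix n n ℂ) (X : Matrix (E × n) (E × n) ℂ)
    (e e' : E) : blk (onSecond E D X) e e' = D (blk X e e') := rfl

theorem ext_blk {X Y : Matrix (E × n) (E × n) ℂ} (h : ∀ e e', blk X e e' = blk Y e e') :
    X = Y := by
  ext ⟨e, a⟩ ⟨e', b⟩
  exact congrFun (congrFun (h e e') a) b

theorem blk_liftEP [DecidableEq A] (X : Matrix (E × P) (E × P) ℂ) (e e' : E) :
    blk (liftEP A X) e e' = liftP A (blk X e e') := rfl

theorem blk_one_kronecker [DecidableEq E] (G : Matrix n n ℂ) (e e' : E) :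
    blk ((1 : Matrix E E ℂ) ⊗ₖ G) e e' = if e = e' then G else 0 := by
  ext a b
  simp only [blk, Matrix.of_apply, Matrix.kroneckerMap_apply, Matrix.one_apply]
  split_ifs <;> simp

theorem blk_kronecker (H : Matrix E E ℂ) (C : Matrix n n ℂ) (e e' : E) :
    blk (H ⊗ₖ C) e e' = H e e' • C := rfl

/-- `id ⊗ D` as a linear map. -/
def onSecondLin (F : Type*) (D : Matrix n n ℂ →ₗ[ℂ] Matrix n n ℂ) :
    Matrix (F × n) (F × n) ℂ →ₗ[ℂ] Matrix (F × n) (F × n) ℂ where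
  toFun := onSecond F D
  map_add' X Y := ext_blk fun e e' => D.map_add (blk X e e') (blk Y e e')
  map_smul' c X := ext_blk fun e e' => D.map_smul c (blk X e e')

variable [Fintype E]

theorem traceEnv_eq_sum (X : Matrix (E × n) (E × n) ℂ) : traceEnv X = ∑ e, blk X e e := by
  ext a b
  simp [traceEnv, blk, Matrix.sum_apply]

/-- The partial trace over the environment as a linear map. -/
def traceEnvLin : Matrix (E × n) (E × n) ℂ →ₗ[ℂ] Matrix n n ℂ where
  toFun := traceEnv
  map_add' X Y := by ext; simp [traceEnv, Finset.sum_add_distrib]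
  map_smul' c X := by ext; simp [traceEnv, Finset.mul_sum]

theorem traceEnv_onSecond (D : Matrix n n ℂ →ₗ[ℂ] Matrix n n ℂ)
    (X : Matrix (E × n) (E × n) ℂ) : traceEnv (onSecond E D X) = D (traceEnv X) := by
  simp only [traceEnv_eq_sum, map_sum, blk_onSecond]

theorem traceEnv_kronecker (H : Matrix E E ℂ) (C : Matrix n n ℂ) :
    traceEnv (H ⊗ₖ C) = H.trace • C := by
  simp only [traceEnv_eq_sum, blk_kronecker, ← Finset.sum_smul]
  rfl

variable [Fintype n]

theorem blk_mul (X Y : Matrix (E × n) (E × n) ℂ) (e e' : E) :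
    blk (X * Y) e e' = ∑ e₁, blk X e e₁ * blk Y e₁ e' := by
  ext a b
  simp [blk, Matrix.mul_apply, Fintype.sum_prod_type, Matrix.sum_apply]

theorem traceEnv_mul (X Y : Matrix (E × n) (E × n) ℂ) :
    traceEnv (X * Y) = ∑ e, ∑ e₁, blk X e e₁ * blk Y e₁ e := by
  simp only [traceEnv_eq_sum, blk_mul]

/-- With the summation indices exchanged, the terms of `Tr_E (X H)` carry the same pairs of blocks
as those of `Tr_E (H X)`, in reversed order. Commutators can then be compared term by term. -/
theorem traceEnv_mul' (X Y : Matrix (E × n) (E × n) ℂ) :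
    traceEnv (X * Y) = ∑ e, ∑ e₁, blk X e₁ e * blk Y e e₁ := by
  rw [traceEnv_mul, Finset.sum_comm]

end Blocks

/-! ### The corrected generator on probe and auxiliary system -/

section Dynamics

variable {E P A n : Type*} [Fintype E] [DecidableEq E] [Fintype n] [DecidableEq n]

/-- The control undoes the commutator with an operator all of whose blocks act as scalars on the
code. -/
theorem map_traceEnv_commutator (D : Matrix n n ℂ →ₗ[ℂ] Matrix n n ℂ)
    (H X : Matrix (E × n) (E × n) ℂ)
    (h : ∀ e e' a b, D (blk H e e' * blk X a b) = D (blk X a b * blk H e e')) :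
    D (traceEnv (hamiltonianTerm H X)) = 0 := by
  have e : hamiltonianTerm H X = (-Complex.I) • (H * X - X * H) := by
    simp [hamiltonianTerm]
  have e2 : traceEnv ((-Complex.I) • (H * X - X * H)) =
      (-Complex.I) • (traceEnv (H * X) - traceEnv (X * H)) := by
    change traceEnvLin _ = _ • (traceEnvLin _ - traceEnvLin _)
    rw [map_smul, map_sub]
  rw [e, e2, traceEnv_mul, traceEnv_mul' X H, map_smul, map_sub]
  simp only [map_sum, h, sub_self, smul_zero]

/-- The operator `1 ⊗ G` is block diagonal with equal blocks, so only diagonal blocks of `X` enter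
and they recombine into `Tr_E X`. The resulting expression is closed in the reduced state. -/
theorem map_traceEnv_signal (D : Matrix n n ℂ →ₗ[ℂ] Matrix n n ℂ) (G K : Matrix n n ℂ)
    (X : Matrix (E × n) (E × n) ℂ)
    (h : ∀ a b, D (G * blk X a b) = K * blk X a b)
    (h' : ∀ a b, D (blk X a b * G) = blk X a b * K) :
    D (traceEnv (hamiltonianTerm ((1 : Matrix E E ℂ) ⊗ₖ G) X)) =
      (-Complex.I) • (K * traceEnv X - traceEnv X * K) := by
  set H := (1 : Matrix E E ℂ) ⊗ₖ G with hH
  have e : hamiltonianTerm H X = (-Complex.I) • (H * X - X * H) := by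
    simp [hamiltonianTerm]
  have e2 : traceEnv ((-Complex.I) • (H * X - X * H)) =
      (-Complex.I) • (traceEnv (H * X) - traceEnv (X * H)) := by
    change traceEnvLin _ = _ • (traceEnvLin _ - traceEnvLin _)
    rw [map_smul, map_sub]
  rw [e, e2, traceEnv_mul, traceEnv_mul' X H, map_smul, map_sub]
  simp only [hH, blk_one_kronecker, ite_mul, mul_ite, zero_mul, mul_zero, Finset.sum_ite_eq,
    Finset.mem_univ, if_true, map_sum, h, h', traceEnv_eq_sum, Finset.mul_sum, Finset.sum_mul]

/-- The control undoes a dissipator whose jump operators have correctable blocks. -/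
theorem map_traceEnv_dissipator (D : Matrix n n ℂ →ₗ[ℂ] Matrix n n ℂ)
    (L X : Matrix (E × n) (E × n) ℂ)
    (h : ∀ e₀ e e' a b, D (blk L e₀ e * blk X a b * (blk L e₀ e').conjTranspose) =
      D ((blk L e₀ e').conjTranspose * blk L e₀ e * blk X a b))
    (h' : ∀ e₀ e e' a b, D (blk X a b * ((blk L e₀ e').conjTranspose * blk L e₀ e)) =
      D ((blk L e₀ e').conjTranspose * blk L e₀ e * blk X a b)) :
    D (traceEnv (dissipator L X)) = 0 := by
  set Lh := L.conjTranspose with hLh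
  have e : dissipator L X = L * (X * Lh) - (1 / 2 : ℂ) • ((Lh * L) * X + X * (Lh * L)) := by
    simp [dissipator, hLh, mul_assoc]
  have e2 : traceEnv (dissipator L X) = traceEnv (L * (X * Lh)) -
      (1 / 2 : ℂ) • (traceEnv ((Lh * L) * X) + traceEnv (X * (Lh * L))) := by
    rw [e]
    change traceEnvLin _ = traceEnvLin _ - _ • (traceEnvLin _ + traceEnvLin _)
    rw [map_sub, map_smul, map_add]
  have hb : ∀ e e', blk (Lh * L) e e' =
      ∑ e₀, (blk L e₀ e).conjTranspose * blk L e₀ e' := fun e e' => by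
    rw [blk_mul]
    rfl
  have h1 : D (traceEnv ((Lh * L) * X)) = ∑ e, ∑ e₁, ∑ e₀,
      D ((blk L e₀ e).conjTranspose * blk L e₀ e₁ * blk X e₁ e) := by
    simp only [traceEnv_mul (Lh * L), hb, Finset.sum_mul, map_sum]
  have h2 : D (traceEnv (X * (Lh * L))) = ∑ e, ∑ e₁, ∑ e₀,
      D ((blk L e₀ e).conjTranspose * blk L e₀ e₁ * blk X e₁ e) := by
    simp only [traceEnv_mul' X, hb, Finset.mul_sum, map_sum, h']
  have h3 : D (traceEnv (L * (X * Lh))) = ∑ e, ∑ e₁, ∑ e₀,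
      D ((blk L e₀ e).conjTranspose * blk L e₀ e₁ * blk X e₁ e) := by
    have e3 : ∀ e₀ e e₁, D (blk L e₀ e₁ * (blk X e₁ e * blk Lh e e₀)) =
        D ((blk L e₀ e).conjTranspose * blk L e₀ e₁ * blk X e₁ e) := fun e₀ e e₁ => by
      rw [← h, ← mul_assoc]
      rfl
    simp only [traceEnv_mul L, blk_mul X, Finset.mul_sum, map_sum, e3]
    calc _ = ∑ e₀, ∑ e, ∑ e₁, D ((blk L e₀ e).conjTranspose * blk L e₀ e₁ * blk X e₁ e) :=
          Finset.sum_congr rfl fun _ _ => Finset.sum_comm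
      _ = ∑ e, ∑ e₀, ∑ e₁, D ((blk L e₀ e).conjTranspose * blk L e₀ e₁ * blk X e₁ e) :=
          Finset.sum_comm
      _ = _ := Finset.sum_congr rfl fun _ _ => Finset.sum_comm
  -- All three terms have become the same sum, with total weight `1 - (1/2) * 2 = 0`.
  rw [e2, map_sub, map_smul, map_add, h1, h2, h3, ← two_smul ℂ, smul_smul]
  norm_num

variable [Fintype P] [DecidableEq P] [Fintype A] [DecidableEq A]

/-- Under a control which corrects the coupling and the jump operators, probe and auxiliary system
evolve by the projected signal only. -/
theorem map_traceEnv_lindbladian {r : ℕ} (M : Model E P r)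
    (D : Matrix (P × A) (P × A) ℂ →ₗ[ℂ] Matrix (P × A) (P × A) ℂ) (K : Matrix (P × A) (P × A) ℂ)
    (ω : ℝ) (X : Matrix (E × (P × A)) (E × (P × A)) ℂ)
    (hH : ∀ e e' a b, D (liftP A (blk M.HEP e e') * blk X a b) =
      D (blk X a b * liftP A (blk M.HEP e e')))
    (hG : ∀ a b, D (liftP A M.G * blk X a b) = K * blk X a b)
    (hG' : ∀ a b, D (blk X a b * liftP A M.G) = blk X a b * K)
    (hL : ∀ k e₀ e e' a b, D (liftP A (blk (M.L k) e₀ e) * blk X a b *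
        (liftP A (blk (M.L k) e₀ e')).conjTranspose) =
      D ((liftP A (blk (M.L k) e₀ e')).conjTranspose * liftP A (blk (M.L k) e₀ e) * blk X a b))
    (hL' : ∀ k e₀ e e' a b, D (blk X a b * ((liftP A (blk (M.L k) e₀ e')).conjTranspose *
        liftP A (blk (M.L k) e₀ e))) =
      D ((liftP A (blk (M.L k) e₀ e')).conjTranspose * liftP A (blk (M.L k) e₀ e) * blk X a b)) :
    D (traceEnv (lindbladian M A ω X)) =
      ((ω : ℂ) * -Complex.I) • (K * traceEnv X - traceEnv X * K) := by
  have e : D (traceEnv (lindbladian M A ω X)) =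
      D (traceEnv (hamiltonianTerm (liftEP A M.HEP) X))
      + (ω : ℂ) • D (traceEnv (hamiltonianTerm ((1 : Matrix E E ℂ) ⊗ₖ liftP A M.G) X))
      + (ω : ℂ) • D (traceEnv
          (hamiltonianTerm (M.HE ⊗ₖ (1 : Matrix (P × A) (P × A) ℂ)) X))
      + ∑ k, D (traceEnv (dissipator (liftEP A (M.L k)) X)) := by
    change (D ∘ₗ traceEnvLin) _ = (D ∘ₗ traceEnvLin) _ + _ • (D ∘ₗ traceEnvLin) _
      + _ • (D ∘ₗ traceEnvLin) _ + ∑ k, (D ∘ₗ traceEnvLin) _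
    rw [lindbladian]
    simp only [LinearMap.add_apply, LinearMap.smul_apply, LinearMap.sum_apply, map_add, map_smul,
      map_sum]
  -- The environment signal is a second instance of the commutator lemma: its blocks are multiples
  -- of the identity.
  rw [e, map_traceEnv_commutator D _ X fun e e' a b => by rw [blk_liftEP]; exact hH e e' a b,
    map_traceEnv_signal D _ K X hG hG',
    map_traceEnv_commutator D _ X fun e e' a b => by simp [blk_kronecker],
    Finset.sum_eq_zero fun k _ => map_traceEnv_dissipator D _ X (fun e₀ e e' a b => by
      simpa only [blk_liftEP] using hL k e₀ e e' a b) (fun e₀ e e' a b => by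
      simpa only [blk_liftEP] using hL' k e₀ e e' a b)]
  simp [smul_smul]

end Dynamics

/-! ### One step of error correction -/

section Control

variable {n : Type*} [Fintype n] [DecidableEq n]

theorem qecStep_apply (Q : Matrix n n ℂ) (R : Matrix n n ℂ →ₗ[ℂ] Matrix n n ℂ)
    (X : Matrix n n ℂ) :
    qecStep Q R X = Q * X * Q + R ((1 - Q) * X * (1 - Q)) := by
  simp [qecStep, mul_assoc]

/-- A factor supported on the code is annihilated by `1 - Q` on its side, so the recovery branch
never contributes and only the compression of `X` remains, whatever `R` is. -/
theorem qecStep_mul_code {Q : Matrix n n ℂ} (hQQ : Q * Q = Q)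
    (R : Matrix n n ℂ →ₗ[ℂ] Matrix n n ℂ) {C : Matrix n n ℂ} (hC : Q * C * Q = C) (X : Matrix n n ℂ) :
    qecStep Q R (X * C) = Q * X * Q * C := by
  have h1 : C * Q = C := by rw [← hC, mul_assoc, hQQ]
  have h2 : Q * C = C := by rw [← hC, ← mul_assoc, ← mul_assoc, hQQ]
  have h3 : (1 - Q) * (X * C) * (1 - Q) = 0 := by
    rw [mul_assoc, mul_assoc X, mul_sub, mul_one, h1, sub_self, mul_zero, mul_zero]
  rw [qecStep_apply, h3, map_zero, add_zero, mul_assoc (Q * X), h2, mul_assoc, mul_assoc, h1,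
    mul_assoc]

theorem qecStep_code_mul {Q : Matrix n n ℂ} (hQQ : Q * Q = Q)
    (R : Matrix n n ℂ →ₗ[ℂ] Matrix n n ℂ) {C : Matrix n n ℂ} (hC : Q * C * Q = C) (X : Matrix n n ℂ) :
    qecStep Q R (C * X) = C * (Q * X * Q) := by
  have h1 : C * Q = C := by rw [← hC, mul_assoc, hQQ]
  have h2 : Q * C = C := by rw [← hC, ← mul_assoc, ← mul_assoc, hQQ]
  rw [qecStep_apply, sub_mul, one_mul, ← mul_assoc Q C, h2,
    sub_self, zero_mul, map_zero, add_zero, ← mul_assoc, ← mul_assoc, h1]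

theorem qecStep_code {Q : Matrix n n ℂ} (hQQ : Q * Q = Q)
    (R : Matrix n n ℂ →ₗ[ℂ] Matrix n n ℂ) {C : Matrix n n ℂ} (hC : Q * C * Q = C) : qecStep Q R C = C := by
  have h1 : C * Q = C := by rw [← hC, mul_assoc, hQQ]
  have := qecStep_code_mul hQQ R hC 1
  rwa [mul_one, mul_one, hQQ, h1] at this

theorem code_qecStep {Q : Matrix n n ℂ} (hQQ : Q * Q = Q)
    (R : Matrix n n ℂ →ₗ[ℂ] Matrix n n ℂ) (hR : ∀ X, Q * R X * Q = R X) (X : Matrix n n ℂ) :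
    Q * qecStep Q R X * Q = qecStep Q R X := by
  rw [qecStep_apply, mul_add, add_mul, hR]
  congr 1
  rw [mul_assoc, mul_assoc (Q * X), hQQ, ← mul_assoc, ← mul_assoc, hQQ]

theorem trace_qecStep {Q : Matrix n n ℂ} (hQQ : Q * Q = Q)
    (R : Matrix n n ℂ →ₗ[ℂ] Matrix n n ℂ) (hR : ∀ X, (R X).trace = X.trace) (X : Matrix n n ℂ) :
    (qecStep Q R X).trace = X.trace := by
  have hT : (1 - Q) * (1 - Q) = 1 - Q := by
    rw [sub_mul, mul_sub, mul_sub, hQQ]; simp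
  rw [qecStep_apply, Matrix.trace_add, hR, Matrix.trace_mul_cycle, hQQ,
    Matrix.trace_mul_cycle (1 - Q), hT, ← Matrix.trace_add, ← add_mul]
  simp

/-- Errors satisfying the Knill–Laflamme conditions are corrected by measuring the code space and
recovering; the constant is fixed by trace preservation. -/
theorem exists_qecStep {α : Type*} (Q : Matrix n n ℂ) (hQh : Q.conjTranspose = Q)
    (hQQ : Q * Q = Q) {u : n → ℂ} (hu : Q.mulVec u = u) (hu1 : star u ⬝ᵥ u = 1)
    (B : α → Matrix n n ℂ)
    (h : ∀ a, ∃ c : ℂ, Q * B a * Q = c • Q)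
    (h' : ∀ a b, ∃ c : ℂ, Q * ((B a).conjTranspose * B b) * Q = c • Q) :
    ∃ R : Matrix n n ℂ →ₗ[ℂ] Matrix n n ℂ, IsRecovery Q R ∧
      ∀ a b C, Q * C * Q = C → qecStep Q R (B a * C * (B b).conjTranspose) =
        qecStep Q R ((B b).conjTranspose * B a * C) := by
  have hTh : (1 - Q).conjTranspose = 1 - Q := by
    rw [Matrix.conjTranspose_sub, Matrix.conjTranspose_one, hQh]
  have hT : (1 - Q) * (1 - Q) = 1 - Q := by
    rw [sub_mul, mul_sub, mul_sub, hQQ]; simp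
  have hstar : ∀ a, ∃ c : ℂ, Q * (B a).conjTranspose * Q = c • Q := fun a => by
    obtain ⟨c, hc⟩ := h a
    refine ⟨star c, ?_⟩
    rw [← hQh, ← Matrix.conjTranspose_smul, hQh, ← hc]
    simp only [Matrix.conjTranspose_mul, hQh, mul_assoc]
  -- The recovery acts only after the measurement has found the state outside the code, so it has to
  -- correct the components `(1 - Q) * B a`. Their Knill–Laflamme constants are those of the
  -- products minus the part that stays in the code.
  obtain ⟨R, hR, hRF⟩ := exists_recovery Q hQh hQQ hu hu1 (fun a => (1 - Q) * B a) (by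
    intro a b
    obtain ⟨c, hc⟩ := h' a b
    obtain ⟨d, hd⟩ := h b
    obtain ⟨d', hd'⟩ := hstar a
    refine ⟨c - d' * d, ?_⟩
    have e : Q * ((1 - Q) * B a).conjTranspose * ((1 - Q) * B b) * Q =
        Q * (B a).conjTranspose * ((1 - Q) * (1 - Q)) * B b * Q := by
      simp only [Matrix.conjTranspose_mul, hTh, mul_assoc]
    have e2 : Q * (B a).conjTranspose * (1 - Q) * B b * Q =
        Q * ((B a).conjTranspose * B b) * Q
        - (Q * (B a).conjTranspose * Q) * (Q * B b * Q) := by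
      have : (Q * (B a).conjTranspose * Q) * (Q * B b * Q) =
          Q * (B a).conjTranspose * (Q * Q) * B b * Q := by simp only [mul_assoc]
      rw [this, hQQ, mul_sub, sub_mul, sub_mul, mul_one]
      simp only [mul_assoc]
    rw [e, hT, e2, hc, hd, hd', smul_mul_smul_comm, hQQ, sub_smul])
  refine ⟨R, hR, fun a b => ?_⟩
  obtain ⟨x, hx⟩ := hRF a b
  obtain ⟨c, hc⟩ := h' b a
  obtain ⟨d, hd⟩ := h a
  obtain ⟨d', hd'⟩ := hstar b
  have key : ∀ C, Q * C * Q = C →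
      qecStep Q R (B a * C * (B b).conjTranspose) = (d * d' + x) • C := by
    intro C hC
    have e1 : Q * (B a * C * (B b).conjTranspose) * Q = (d * d') • C := by
      calc _ = (Q * B a * Q) * C * (Q * (B b).conjTranspose * Q) := by
            conv_lhs => rw [← hC]
            simp only [mul_assoc]
        _ = _ := by
            rw [hd, hd', smul_mul_assoc, smul_mul_smul_comm, hC]
    have e2 : (1 - Q) * (B a * C * (B b).conjTranspose) * (1 - Q) =
        ((1 - Q) * B a) * C * ((1 - Q) * B b).conjTranspose := by
      rw [Matrix.conjTranspose_mul, hTh]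
      simp only [mul_assoc]
    rw [qecStep_apply, e1, e2, hx C hC, add_smul]
  -- Comparing traces on the single code state `|u⟩⟨u|` determines the constant.
  have hy : d * d' + x = c := by
    set C₀ := ketBra u with hC₀
    have htr : C₀.trace = 1 := by
      rw [hC₀, ketBra, Matrix.trace_vecMulVec, dotProduct_comm, hu1]
    have hQC : Q * C₀ * Q = C₀ := by
      have h1 : star u = Matrix.vecMul (star u) Q := by
        conv_lhs => rw [← hu, Matrix.star_mulVec, hQh]
      rw [hC₀, ketBra, Matrix.mul_vecMulVec, Matrix.vecMulVec_mul, hu, ← h1]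
    have h1 := congrArg Matrix.trace (key C₀ hQC)
    rw [trace_qecStep hQQ R hR.1.2, Matrix.trace_smul, htr, smul_eq_mul, mul_one] at h1
    rw [← h1]
    have h2 : (B a * C₀ * (B b).conjTranspose).trace =
        ((Q * ((B b).conjTranspose * B a) * Q) * C₀).trace := by
      conv_lhs => rw [← hQC]
      rw [Matrix.trace_mul_comm, ← mul_assoc, ← mul_assoc, Matrix.trace_mul_comm]
      simp only [mul_assoc]
    rw [h2, hc, smul_mul_assoc, Matrix.trace_smul]
    have : Q * C₀ = C₀ := by rw [← hQC, ← mul_assoc, ← mul_assoc, hQQ]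
    rw [this, htr, smul_eq_mul, mul_one]
  intro C hC
  have h2 : Q * C = C := by rw [← hC, ← mul_assoc, ← mul_assoc, hQQ]
  rw [key C hC, hy, qecStep_mul_code hQQ R hC, hc, smul_mul_assoc, h2]

end Control

/-! ### Phase states and their quantum Fisher information -/

section Fisher

variable {n : Type*}

/-- The equal superposition of the code words, with phases acquired from `lam`. -/
def phaseState (C : Fin 2 → n → ℂ) (lam : Fin 2 → ℝ) (s : ℝ) : n → ℂ :=
  ((1 / Real.sqrt 2 : ℝ) : ℂ) • ∑ i, Complex.exp (-(s * lam i * Complex.I)) • C i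

theorem ketBra_phaseState (C : Fin 2 → n → ℂ) (lam : Fin 2 → ℝ) (s : ℝ) :
    ketBra (phaseState C lam s) = ∑ i, ∑ j,
      (Complex.exp (-(s * (lam i - lam j) * Complex.I)) / 2) •
        Matrix.vecMulVec (C i) (star (C j)) := by
  have h2 : ((1 / Real.sqrt 2 : ℝ) : ℂ) * ((1 / Real.sqrt 2 : ℝ) : ℂ) = 1 / 2 := by
    rw [← Complex.ofReal_mul, div_mul_div_comm, Real.mul_self_sqrt (by norm_num)]
    norm_num
  have he : ∀ i j, Complex.exp (-(s * (lam i - lam j) * Complex.I)) =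
      Complex.exp (-(s * lam i * Complex.I)) *
        (starRingEnd ℂ) (Complex.exp (-(s * lam j * Complex.I))) := by
    intro i j
    rw [← Complex.exp_conj, ← Complex.exp_add]
    congr 1
    simp
    ring
  ext a b
  simp only [Fin.sum_univ_two, he, ketBra, phaseState, Matrix.vecMulVec_apply, Matrix.add_apply,
    Matrix.smul_apply, Pi.smul_apply, Pi.star_apply, Pi.add_apply, smul_eq_mul]
  simp only [star_mul', star_add, RCLike.star_def, Complex.conj_ofReal]
  linear_combination ((Complex.exp (-(s * lam 0 * Complex.I)) * C 0 a
    + Complex.exp (-(s * lam 1 * Complex.I)) * C 1 a) *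
    ((starRingEnd ℂ) (Complex.exp (-(s * lam 0 * Complex.I))) * (starRingEnd ℂ) (C 0 b)
    + (starRingEnd ℂ) (Complex.exp (-(s * lam 1 * Complex.I))) * (starRingEnd ℂ) (C 1 b))) * h2

variable [Fintype n]

theorem ketBra_mul_ketBra {v : n → ℂ} (hv : star v ⬝ᵥ v = 1) : ketBra v * ketBra v = ketBra v := by
  rw [ketBra, Matrix.vecMulVec_mul_vecMulVec, hv]
  simp

theorem isDensityMatrix_ketBra {v : n → ℂ} (hv : star v ⬝ᵥ v = 1) :
    IsDensityMatrix (ketBra v) := by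
  refine ⟨Matrix.posSemidef_vecMulVec_self_star v, ?_⟩
  rw [ketBra, Matrix.trace_vecMulVec, dotProduct_comm, hv]

theorem phaseState_normalized {C : Fin 2 → n → ℂ}
    (hC : ∀ i j, star (C i) ⬝ᵥ C j = if i = j then 1 else 0) (lam : Fin 2 → ℝ) (s : ℝ) :
    star (phaseState C lam s) ⬝ᵥ phaseState C lam s = 1 := by
  have h1 : (ketBra (phaseState C lam s)).trace =
      star (phaseState C lam s) ⬝ᵥ phaseState C lam s := by
    rw [ketBra, Matrix.trace_vecMulVec, dotProduct_comm]
  have h3 : ∀ i j, C i ⬝ᵥ star (C j) = if j = i then 1 else 0 := fun i j => by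
    rw [dotProduct_comm, hC]
  rw [← h1, ketBra_phaseState]
  simp [Matrix.trace_smul, Matrix.trace_vecMulVec, h3]
  norm_num

variable [DecidableEq n]

/-- Parseval in each column, then invariance of the trace under change of orthonormal basis. It
evaluates the Fisher sum once all its denominators equal one. -/
theorem sum_norm_sq_matrixElements (b : OrthonormalBasis n ℂ (EuclideanSpace ℂ n))
    (X : Matrix n n ℂ) :
    (∑ i, ∑ j, ‖star (b i).ofLp ⬝ᵥ X.mulVec (b j).ofLp‖ ^ 2 : ℝ) =
      (X.conjTranspose * X).trace.re := by
  have h1 : ∀ j, (∑ i, ‖star (b i).ofLp ⬝ᵥ X.mulVec (b j).ofLp‖ ^ 2 : ℝ) =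
      (star (b j).ofLp ⬝ᵥ (X.conjTranspose * X).mulVec (b j).ofLp).re := by
    intro j
    have := b.sum_sq_norm_inner_right (WithLp.toLp 2 (X.mulVec (b j).ofLp))
    have e : ∀ i, inner ℂ (b i) (WithLp.toLp 2 (X.mulVec (b j).ofLp)) =
        star (b i).ofLp ⬝ᵥ X.mulVec (b j).ofLp := fun i => by
      rw [EuclideanSpace.inner_eq_star_dotProduct, dotProduct_comm]
    simp only [e] at this
    rw [this, ← Matrix.mulVec_mulVec, Matrix.dotProduct_mulVec, ← Matrix.star_mulVec,
      @norm_sq_eq_re_inner ℂ, EuclideanSpace.inner_eq_star_dotProduct, dotProduct_comm]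
    rfl
  rw [Finset.sum_comm]
  simp only [h1]
  set Y := X.conjTranspose * X
  rw [← Complex.re_sum]
  congr 1
  let U : Matrix n n ℂ := Matrix.of fun a k => b k a
  have hU : star U * U = 1 := by
    ext i j
    have := orthonormal_iff_ite.1 b.orthonormal i j
    rw [EuclideanSpace.inner_eq_star_dotProduct, dotProduct_comm] at this
    rw [Matrix.one_apply, ← this]
    rfl
  have hU' : U * star U = 1 := mul_eq_one_comm.1 hU
  have h2 : Y.trace = (star U * Y * U).trace := by
    rw [Matrix.trace_mul_cycle, hU', one_mul]
  rw [h2]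
  refine Finset.sum_congr rfl fun k _ => ?_
  rw [Matrix.diag_apply, mul_assoc, Matrix.mul_apply]
  simp only [dotProduct, Matrix.mulVec, Matrix.mul_apply (M := Y)]
  rfl

/-- The quantum Fisher information of a family of pure states. -/
theorem qfi_eq_of_mul_add_mul {ρ ρ' : Matrix n n ℂ} (hρ : ρ.IsHermitian)
    (h : ρ * ρ' + ρ' * ρ = ρ') : qfi ρ hρ ρ' = 2 * (ρ'.conjTranspose * ρ').trace.re := by
  rw [qfi, ← sum_norm_sq_matrixElements hρ.eigenvectorBasis]
  congr 1
  refine Finset.sum_congr rfl fun i _ => Finset.sum_congr rfl fun j _ => ?_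
  set u := (hρ.eigenvectorBasis i).ofLp
  set v := (hρ.eigenvectorBasis j).ofLp
  set x := star u ⬝ᵥ ρ'.mulVec v with hx
  have h1 : ρ.mulVec v = hρ.eigenvalues j • v := hρ.mulVec_eigenvectorBasis j
  have h2 : Matrix.vecMul (star u) ρ = hρ.eigenvalues i • star u := by
    have : star (ρ.mulVec u) = star (hρ.eigenvalues i • u) := by
      rw [hρ.mulVec_eigenvectorBasis i]
    rw [Matrix.star_mulVec, hρ] at this
    rw [this]
    simp
  -- Sandwiching the hypothesis between eigenvectors shows that a matrix element is zero unless its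
  -- eigenvalues sum to 1. Every nonzero term thus passes the positivity test with denominator 1.
  have h3 : x = ((hρ.eigenvalues i + hρ.eigenvalues j : ℝ) : ℂ) * x := by
    conv_lhs => rw [hx, ← h]
    rw [Matrix.add_mulVec, dotProduct_add, ← Matrix.mulVec_mulVec, ← Matrix.mulVec_mulVec, h1,
      Matrix.dotProduct_mulVec, h2, smul_dotProduct, Matrix.mulVec_smul, dotProduct_smul, ← hx]
    simp only [Complex.real_smul]
    push_cast
    ring
  rcases eq_or_ne x 0 with h0 | h0
  · simp [h0]
  · have h4 : ((hρ.eigenvalues i + hρ.eigenvalues j : ℝ) : ℂ) = 1 := by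
      have : (((hρ.eigenvalues i + hρ.eigenvalues j : ℝ) : ℂ) - 1) * x = 0 := by
        rw [sub_mul, ← h3]; ring
      exact sub_eq_zero.1 ((mul_eq_zero.1 this).resolve_right h0)
    have h5 : hρ.eigenvalues i + hρ.eigenvalues j = 1 := by exact_mod_cast h4
    rw [h5]
    simp

/-- A phase acquired at rate `t (lam 0 - lam 1)` has Heisenberg-limited Fisher information. -/
theorem hasQFIAt_phaseState {C : Fin 2 → n → ℂ}
    (hC : ∀ i j, star (C i) ⬝ᵥ C j = if i = j then 1 else 0) (lam : Fin 2 → ℝ) (ω t : ℝ) :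
    HasQFIAt (fun w => ketBra (phaseState C lam (w * t))) ω (t ^ 2 * (lam 0 - lam 1) ^ 2) := by
  have hd : ∀ w, IsDensityMatrix (ketBra (phaseState C lam (w * t))) := fun w =>
    isDensityMatrix_ketBra (phaseState_normalized hC lam _)
  -- The coefficients of the state in the matrix units `Z i j`; `δ` below holds their logarithmic
  -- derivatives in `ω`, which vanish on the diagonal.
  set m : Fin 2 → Fin 2 → ℂ := fun i j =>
    Complex.exp (-((ω * t : ℝ) * (lam i - lam j) * Complex.I)) / 2 with hm
  set δ : Fin 2 → Fin 2 → ℂ := fun i j => -(t * (lam i - lam j) * Complex.I) with hδ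
  set Z : Fin 2 → Fin 2 → Matrix n n ℂ := fun i j => Matrix.vecMulVec (C i) (star (C j)) with hZ
  have hZZ : ∀ i j k l, Z i j * Z k l = if j = k then Z i l else 0 := by
    intro i j k l
    simp only [hZ]
    rw [Matrix.vecMulVec_mul_vecMulVec, hC]
    split_ifs <;> simp
  have hZh : ∀ i j, (Z i j).conjTranspose = Z j i := by
    intro i j
    simp [hZ, Matrix.conjTranspose_vecMulVec]
  have hZt : ∀ i j, (Z i j).trace = if j = i then 1 else 0 := by
    intro i j
    simp only [hZ]
    rw [Matrix.trace_vecMulVec, dotProduct_comm, hC]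
  set ρ' : Matrix n n ℂ := ∑ i, ∑ j, (m i j * δ i j) • Z i j with hρ'
  have hmm : ∀ i j k, m i j * m j k = m i k / 2 := by
    intro i j k
    simp only [hm]
    rw [div_mul_div_comm, ← Complex.exp_add, div_div]
    congr 2
    ring
  have hder : ∀ a b, HasDerivAt (fun w => ketBra (phaseState C lam (w * t)) a b) (ρ' a b) ω := by
    intro a b
    simp only [ketBra_phaseState]
    have : ∀ i j, HasDerivAt (fun w : ℝ =>
        Complex.exp (-((w * t : ℝ) * (lam i - lam j) * Complex.I)) / 2 * Z i j a b)
        (m i j * δ i j * Z i j a b) ω := by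
      intro i j
      have h1 : HasDerivAt (fun w : ℝ => -((w * t : ℝ) * (lam i - lam j) * Complex.I : ℂ))
          (δ i j) ω := by
        have := ((((Complex.ofRealCLM.hasDerivAt (x := ω)).mul_const (t : ℂ)).mul_const
          (lam i - lam j : ℂ)).mul_const Complex.I).neg
        refine (this.congr_deriv ?_).congr_of_eventuallyEq (.of_forall fun w => ?_)
        · simp [hδ]
        · simp
      have h2 := (h1.cexp.div_const 2).mul_const (Z i j a b)
      refine h2.congr_deriv ?_
      simp only [hm]
      ring
    have hs := HasDerivAt.fun_sum fun i (_ : i ∈ Finset.univ) =>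
      HasDerivAt.fun_sum fun j (_ : j ∈ Finset.univ) => this i j
    simpa only [hρ', Matrix.sum_apply, Matrix.smul_apply, smul_eq_mul] using hs
  refine ⟨hd, (hd ω).1.1, ρ', hder, ?_⟩
  · rw [qfi_eq_of_mul_add_mul]
    · have h01 : m 0 1 * m 1 0 = 1 / 4 := by
        rw [hmm]; simp [hm]; norm_num
      have hst : ∀ i j, star (m i j * δ i j) = m j i * δ j i := by
        intro i j
        have h1 : star (m i j) = m j i := by
          simp only [hm, star_div₀, RCLike.star_def, ← Complex.exp_conj, map_ofNat]
          congr 2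
          simp only [map_neg, map_mul, map_sub, Complex.conj_ofReal, Complex.conj_I]
          ring
        have h2 : star (δ i j) = δ j i := by
          simp only [hδ, RCLike.star_def, map_neg, map_mul, map_sub, Complex.conj_ofReal,
            Complex.conj_I]
          ring
        rw [star_mul', h1, h2]
      have hh : ρ'.conjTranspose = ρ' := by
        rw [hρ', Matrix.conjTranspose_sum]
        simp only [Matrix.conjTranspose_sum, Matrix.conjTranspose_smul, hst, hZh]
        exact Finset.sum_comm
      rw [hh]
      have : (ρ' * ρ').trace = (t ^ 2 * (lam 0 - lam 1) ^ 2 / 2 : ℝ) := by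
        have e : ρ' = (m 0 1 * δ 0 1) • Z 0 1 + (m 1 0 * δ 1 0) • Z 1 0 := by
          simp [hρ', Fin.sum_univ_two, hδ]
        have e2 : ρ' * ρ' = (m 0 1 * m 1 0 * (δ 0 1 * δ 1 0)) • (Z 0 0 + Z 1 1) := by
          rw [e]
          simp only [mul_add, add_mul, smul_mul_smul_comm, hZZ]
          simp
          rw [show m 1 0 * δ 1 0 * (m 0 1 * δ 0 1) = m 0 1 * m 1 0 * (δ 0 1 * δ 1 0) by ring,
            show m 0 1 * δ 0 1 * (m 1 0 * δ 1 0) = m 0 1 * m 1 0 * (δ 0 1 * δ 1 0) by ring,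
            add_comm]
        rw [e2, Matrix.trace_smul, Matrix.trace_add, hZt, hZt, h01]
        simp only [hδ, if_true, smul_eq_mul]
        push_cast
        linear_combination (-(1 / 2 : ℂ) * t ^ 2 * (lam 0 - lam 1) ^ 2) * Complex.I_sq
      rw [this, Complex.ofReal_re]
      ring
    -- The relation is the derivative of `ρ² = ρ`, valid along the family because every member is
    -- pure; uniqueness of derivatives gives the identity.
    · ext a b
      have h1 := HasDerivAt.fun_sum fun c (_ : c ∈ Finset.univ) => (hder a c).mul (hder c b)
      have h2 : (fun w => ∑ c, ketBra (phaseState C lam (w * t)) a c *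
          ketBra (phaseState C lam (w * t)) c b) =
          fun w => ketBra (phaseState C lam (w * t)) a b := by
        funext w
        rw [← Matrix.mul_apply, ketBra_mul_ketBra (phaseState_normalized hC lam _)]
      have h3 := (h2 ▸ h1).unique (hder a b)
      rw [← h3, Matrix.add_apply, Matrix.mul_apply, Matrix.mul_apply, ← Finset.sum_add_distrib]
      exact Finset.sum_congr rfl fun c _ => add_comm _ _

end Fisher

/-! ### The extended span: adjoints and independence of the environment basis -/

section ExtendedSpan

variable {E P ι : Type*} [Fintype E] [Fintype ι] (φ : OrthonormalBasis ι ℂ (EuclideanSpace ℂ E))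

theorem probeBlock_conjTranspose (X : Matrix (E × P) (E × P) ℂ) (i j : ι) :
    (probeBlock φ X i j).conjTranspose = probeBlock φ X.conjTranspose j i := by
  ext p q
  simp only [probeBlock, Matrix.conjTranspose_apply, Matrix.of_apply, star_sum, star_mul',
    star_star]
  rw [Finset.sum_comm]
  refine Finset.sum_congr rfl fun e _ => Finset.sum_congr rfl fun e' _ => ?_
  ring

/-- Blocks in the standard basis in terms of blocks in the basis `φ`. -/
theorem blk_eq_sum_probeBlock [DecidableEq E] (X : Matrix (E × P) (E × P) ℂ)
    (e e' : E) :
    blk X e e' = ∑ i, ∑ j, (φ i e * star (φ j e')) • probeBlock φ X i j := by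
  have hc : ∀ a b, ∑ i, φ i a * star (φ i b) = if b = a then 1 else 0 := by
    intro a b
    have := φ.sum_inner_mul_inner (EuclideanSpace.single a (1 : ℂ))
      (EuclideanSpace.single b (1 : ℂ))
    simp only [EuclideanSpace.inner_single_left, EuclideanSpace.inner_single_right] at this
    simpa [eq_comm, Pi.single_apply] using this
  ext p q
  simp only [blk, Matrix.of_apply, Matrix.sum_apply, Matrix.smul_apply, probeBlock, smul_eq_mul]
  have h1 : ∀ i j, φ i e * star (φ j e') * ∑ a, ∑ b, star (φ i a) * X (a, p) (b, q) * φ j b =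
      ∑ a, ∑ b, (φ i e * star (φ i a)) * ((φ j b * star (φ j e')) * X (a, p) (b, q)) := by
    intro i j
    simp only [Finset.mul_sum]
    refine Finset.sum_congr rfl fun a _ => Finset.sum_congr rfl fun b _ => ?_
    ring
  simp only [h1]
  symm
  calc _ = ∑ a, ∑ i, ∑ j, ∑ b, (φ i e * star (φ i a)) *
        ((φ j b * star (φ j e')) * X (a, p) (b, q)) :=
        (Finset.sum_congr rfl fun _ _ => Finset.sum_comm).trans Finset.sum_comm
    _ = ∑ a, (∑ i, φ i e * star (φ i a)) *
        ∑ b, (∑ j, φ j b * star (φ j e')) * X (a, p) (b, q) := by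
        refine Finset.sum_congr rfl fun a _ => ?_
        rw [Finset.sum_mul]
        refine Finset.sum_congr rfl fun i _ => ?_
        rw [Finset.sum_comm]
        simp only [Finset.mul_sum, Finset.sum_mul]
    _ = _ := by
        simp only [hc]
        simp

variable [Fintype P] [DecidableEq P] {r : ℕ} (M : Model E P r)

theorem one_mem_extendedSpan : 1 ∈ extendedSpan M φ :=
  Submodule.subset_span (Or.inl (Or.inl (Or.inl (Or.inl rfl))))

/-- Adjoints permute the generators: blocks of `H_EP` swap indices, those of `L_k` and `L_k†` are
interchanged, and the products reverse. This is what allows the separating matrix to be Hermitian.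
-/
theorem conjTranspose_mem_extendedSpan {X : Matrix P P ℂ} (hX : X ∈ extendedSpan M φ) :
    X.conjTranspose ∈ extendedSpan M φ := by
  induction hX using Submodule.span_induction with
  | mem x hx =>
    rcases hx with (((h | ⟨i, m, rfl⟩) | ⟨k, i, m, rfl⟩) | ⟨k, i, m, rfl⟩) |
      ⟨k, j, i, m, n, l, rfl⟩
    · rw [Set.mem_singleton_iff.1 h, Matrix.conjTranspose_one]
      exact one_mem_extendedSpan φ M
    · rw [probeBlock_conjTranspose, M.HEP_isHermitian]
      exact Submodule.subset_span (Or.inl (Or.inl (Or.inl (Or.inr ⟨m, i, rfl⟩))))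
    · rw [probeBlock_conjTranspose]
      exact Submodule.subset_span (Or.inl (Or.inr ⟨k, m, i, rfl⟩))
    · rw [probeBlock_conjTranspose, Matrix.conjTranspose_conjTranspose]
      exact Submodule.subset_span (Or.inl (Or.inl (Or.inr ⟨k, m, i, rfl⟩)))
    · rw [Matrix.conjTranspose_mul, probeBlock_conjTranspose, probeBlock_conjTranspose,
        Matrix.conjTranspose_conjTranspose]
      exact Submodule.subset_span (Or.inr ⟨j, k, l, n, m, i, rfl⟩)
  | zero => rw [Matrix.conjTranspose_zero]; exact zero_mem _
  | add x y _ _ hx hy => rw [Matrix.conjTranspose_add]; exact add_mem hx hy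
  | smul a x _ hx => rw [Matrix.conjTranspose_smul]; exact Submodule.smul_mem _ _ hx

variable [DecidableEq E]

theorem blk_HEP_mem (e e' : E) : blk M.HEP e e' ∈ extendedSpan M φ := by
  rw [blk_eq_sum_probeBlock φ]
  exact sum_mem fun i _ => sum_mem fun j _ => Submodule.smul_mem _ _
    (Submodule.subset_span (Or.inl (Or.inl (Or.inl (Or.inr ⟨i, j, rfl⟩)))))

theorem blk_L_mem (k : Fin r) (e e' : E) : blk (M.L k) e e' ∈ extendedSpan M φ := by
  rw [blk_eq_sum_probeBlock φ]
  exact sum_mem fun i _ => sum_mem fun j _ => Submodule.smul_mem _ _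
    (Submodule.subset_span (Or.inl (Or.inl (Or.inr ⟨k, i, j, rfl⟩))))

theorem blk_L_mul_blk_L_mem (k j : Fin r) (e₁ e₂ e₃ e₄ : E) :
    (blk (M.L k) e₁ e₂).conjTranspose * blk (M.L j) e₃ e₄ ∈ extendedSpan M φ := by
  rw [← blk_conjTranspose, blk_eq_sum_probeBlock φ, blk_eq_sum_probeBlock φ]
  simp only [Finset.sum_mul, Finset.mul_sum, smul_mul_smul_comm]
  exact sum_mem fun _ _ => sum_mem fun _ _ => sum_mem fun _ _ => sum_mem fun _ _ =>
    Submodule.smul_mem _ _ (Submodule.subset_span (Or.inr ⟨_, _, _, _, _, _, rfl⟩))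

end ExtendedSpan

/-! ### Algebra of the code projector -/

section CodeSpace

variable {n : Type*}

theorem codeProj_eq_sum (C : Fin 2 → n → ℂ) :
    codeProj (C 0) (C 1) = ∑ i, Matrix.vecMulVec (C i) (star (C i)) := by
  rw [Fin.sum_univ_two]
  rfl

theorem codeProj_conjTranspose (C₀ C₁ : n → ℂ) :
    (codeProj C₀ C₁).conjTranspose = codeProj C₀ C₁ := by
  simp [codeProj, ketBra, Matrix.conjTranspose_vecMulVec]

variable [Fintype n]

theorem codeProj_mul_mul (C : Fin 2 → n → ℂ) (X : Matrix n n ℂ) :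
    codeProj (C 0) (C 1) * X * codeProj (C 0) (C 1) =
      ∑ i, ∑ j, (star (C i) ⬝ᵥ X.mulVec (C j)) • Matrix.vecMulVec (C i) (star (C j)) := by
  simp only [codeProj_eq_sum, Finset.sum_mul, Finset.mul_sum]
  rw [Finset.sum_comm]
  refine Finset.sum_congr rfl fun i _ => Finset.sum_congr rfl fun j _ => ?_
  rw [Matrix.vecMulVec_mul, Matrix.vecMulVec_mul_vecMulVec, ← Matrix.dotProduct_mulVec,
    Matrix.vecMulVec_smul]

theorem codeProj_mul_mul_of_scalar (C : Fin 2 → n → ℂ) (X : Matrix n n ℂ) (c : ℂ)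
    (h : ∀ i j, star (C i) ⬝ᵥ X.mulVec (C j) = if i = j then c else 0) :
    codeProj (C 0) (C 1) * X * codeProj (C 0) (C 1) = c • codeProj (C 0) (C 1) := by
  rw [codeProj_mul_mul, codeProj_eq_sum, Finset.smul_sum]
  simp [h]

theorem codeProj_mulVec {C : Fin 2 → n → ℂ}
    (hC : ∀ i j, star (C i) ⬝ᵥ C j = if i = j then 1 else 0) (j : Fin 2) : (codeProj (C 0) (C 1)).mulVec (C j) = C j := by
  rw [codeProj_eq_sum, Matrix.sum_mulVec]
  simp [Matrix.vecMulVec_mulVec, hC]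

theorem codeProj_mul_self [DecidableEq n] {C : Fin 2 → n → ℂ}
    (hC : ∀ i j, star (C i) ⬝ᵥ C j = if i = j then 1 else 0) :
    codeProj (C 0) (C 1) * codeProj (C 0) (C 1) = codeProj (C 0) (C 1) := by
  have := codeProj_mul_mul_of_scalar C 1 1 (by simpa using hC)
  simpa using this

theorem sum_vecMulVec_mulVec {C : Fin 2 → n → ℂ}
    (hC : ∀ i j, star (C i) ⬝ᵥ C j = if i = j then 1 else 0) (lam : Fin 2 → ℂ) (j : Fin 2) :
    (∑ i, lam i • Matrix.vecMulVec (C i) (star (C i))).mulVec (C j) = lam j • C j := by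
  rw [Matrix.sum_mulVec]
  simp [Matrix.smul_mulVec, Matrix.vecMulVec_mulVec, hC]

theorem vecMul_sum_vecMulVec {C : Fin 2 → n → ℂ}
    (hC : ∀ i j, star (C i) ⬝ᵥ C j = if i = j then 1 else 0) (lam : Fin 2 → ℂ) (j : Fin 2) :
    Matrix.vecMul (star (C j)) (∑ i, lam i • Matrix.vecMulVec (C i) (star (C i))) =
      lam j • star (C j) := by
  rw [Matrix.vecMul_sum]
  simp [Matrix.vecMul_smul, Matrix.vecMul_vecMulVec, hC]

end CodeSpace

theorem liftP_mul {P A : Type*} [Fintype P] [Fintype A] [DecidableEq A] (X Y : Matrix P P ℂ) :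
    liftP A (X * Y) = liftP A X * liftP A Y := by
  rw [liftP, liftP, liftP, ← Matrix.mul_kronecker_mul, one_mul]

theorem liftP_conjTranspose {P A : Type*} [DecidableEq A] (X : Matrix P P ℂ) :
    liftP A X.conjTranspose = (liftP A X).conjTranspose := by
  rw [liftP, liftP, Matrix.conjTranspose_kronecker, Matrix.conjTranspose_one]

/-! ### The state under infinitely fast error correction -/

section Limit

attribute [local instance] Matrix.normedAddCommGroup Matrix.normedSpace

variable {E P A : Type*} [Fintype E] [DecidableEq E] [Fintype P] [DecidableEq P] [Fintype A]
  [DecidableEq A]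

/-- The matrix element `⟨u| Tr_E X |v⟩` as a linear functional of `X`. -/
def envMatrixElement {n : Type*} [Fintype n] (u v : n → ℂ) :
    Matrix (E × n) (E × n) ℂ →ₗ[ℂ] ℂ where
  toFun X := star u ⬝ᵥ (traceEnv X).mulVec v
  map_add' X Y := by
    change star u ⬝ᵥ (traceEnvLin (X + Y)).mulVec v = _
    rw [map_add, Matrix.add_mulVec, dotProduct_add]
    rfl
  map_smul' c X := by
    change star u ⬝ᵥ (traceEnvLin (c • X)).mulVec v = _
    rw [map_smul, Matrix.smul_mulVec, dotProduct_smul]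
    rfl

/-- The state under infinitely fast control which undoes the coupling and the noise to first order,
and leaves the projected signal with eigenvalues `lam` on the code. -/
theorem tendsto_controlledState {r : ℕ} (M : Model E P r) {C : Fin 2 → P × A → ℂ}
    (hC : ∀ i j, star (C i) ⬝ᵥ C j = if i = j then 1 else 0) (lam : Fin 2 → ℝ)
    (D : Matrix (P × A) (P × A) ℂ →ₗ[ℂ] Matrix (P × A) (P × A) ℂ)
    (hDQ : ∀ X, codeProj (C 0) (C 1) * D X * codeProj (C 0) (C 1) = D X)
    (hDC : ∀ X, codeProj (C 0) (C 1) * X * codeProj (C 0) (C 1) = X → D X = X)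
    (ω : ℝ)
    (hgen : ∀ X : Matrix (E × (P × A)) (E × (P × A)) ℂ,
      (∀ a b, codeProj (C 0) (C 1) * blk X a b * codeProj (C 0) (C 1) = blk X a b) →
      D (traceEnv (lindbladian M A ω X)) = ((ω : ℂ) * -Complex.I) •
        ((∑ i, (lam i : ℂ) • Matrix.vecMulVec (C i) (star (C i))) * traceEnv X
          - traceEnv X * ∑ i, (lam i : ℂ) • Matrix.vecMulVec (C i) (star (C i))))
    {ρE : Matrix E E ℂ} (hρE : ρE.trace = 1) {t : ℝ} (ht : 0 ≤ t) :
    Filter.Tendsto (fun N : ℕ => controlledState M D ρE (ketBra (phaseState C lam 0)) ω t N)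
      Filter.atTop (𝓝 (ketBra (phaseState C lam (ω * t)))) := by
  set Q := codeProj (C 0) (C 1) with hQ
  set K := ∑ i, (lam i : ℂ) • Matrix.vecMulVec (C i) (star (C i)) with hK
  set 𝓛 := lindbladian M A ω
  set x₀ := ρE ⊗ₖ ketBra (phaseState C lam 0) with hx₀
  have hDD : ∀ X, D (D X) = D X := fun X => hDC _ (hDQ X)
  have hcode : Q * ketBra (phaseState C lam 0) * Q = ketBra (phaseState C lam 0) := by
    have h1 : Q.mulVec (phaseState C lam 0) = phaseState C lam 0 := by
      simp only [phaseState, Matrix.mulVec_smul, Matrix.mulVec_sum, hQ, codeProj_mulVec hC]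
    have h2 : Matrix.vecMul (star (phaseState C lam 0)) Q = star (phaseState C lam 0) := by
      conv_lhs => rw [hQ, ← codeProj_conjTranspose, ← Matrix.star_mulVec, ← hQ, h1]
    rw [ketBra, Matrix.mul_vecMulVec, Matrix.vecMulVec_mul, h1, h2]
  have hfix : onSecondLin E D x₀ = x₀ := by
    refine ext_blk fun e e' => ?_
    change D (blk x₀ e e') = _
    rw [hx₀, blk_kronecker, map_smul, hDC _ hcode]
  have hDD' : ∀ x, onSecondLin E D (onSecondLin E D x) = onSecondLin E D x := fun x =>
    ext_blk fun e e' => hDD (blk x e e')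
  have hzero : ∀ x : Matrix (E × (P × A)) (E × (P × A)) ℂ, semigroup 𝓛 0 x = x :=
    fun x => semigroup_zero 𝓛 x
  -- The norm in force is the entrywise supremum, so differentiability reduces to single entries.
  have hder : ∀ x : Matrix (E × (P × A)) (E × (P × A)) ℂ,
      HasDerivAt (fun τ => semigroup 𝓛 τ x) (𝓛 x) 0 := by
    intro x
    refine hasDerivAt_pi.2 fun a => hasDerivAt_pi.2 fun b => ?_
    have := hasDerivAt_semigroup 𝓛 x 0 a b
    rwa [semigroup_zero] at this
  have hgen' : ∀ i j x, onSecondLin E D x = x →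
      envMatrixElement (C i) (C j) (onSecondLin E D (𝓛 x)) =
        (-(ω * (lam i - lam j)) : ℝ) * Complex.I * envMatrixElement (C i) (C j) x := by
    intro i j x hx
    have hb : ∀ a b, Q * blk x a b * Q = blk x a b := fun a b => by
      rw [← hx]; exact hDQ (blk x a b)
    change star (C i) ⬝ᵥ (traceEnv (onSecond E D (𝓛 x))).mulVec (C j) =
      _ * (star (C i) ⬝ᵥ (traceEnv x).mulVec (C j))
    rw [traceEnv_onSecond, hgen x hb, Matrix.smul_mulVec, Matrix.sub_mulVec,
      ← Matrix.mulVec_mulVec, ← Matrix.mulVec_mulVec, sum_vecMulVec_mulVec hC,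
      dotProduct_smul, dotProduct_sub, Matrix.dotProduct_mulVec _ K, vecMul_sum_vecMulVec hC,
      Matrix.mulVec_smul, dotProduct_smul, smul_dotProduct]
    simp only [smul_eq_mul]
    push_cast
    ring
  have hzeno : ∀ i j, Filter.Tendsto (fun N : ℕ => envMatrixElement (C i) (C j)
      ((controlledRound M D ω (t / N))^[N] x₀)) Filter.atTop
      (𝓝 (Complex.exp (-((ω * t : ℝ) * (lam i - lam j) * Complex.I)) / 2)) := by
    intro i j
    have hz := tendsto_zeno (V := Matrix (E × (P × A)) (E × (P × A)) ℂ)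
      (onSecondLin E D) (fun τ => semigroup 𝓛 τ) 𝓛 (envMatrixElement (C i) (C j))
      (-(ω * (lam i - lam j))) hDD' hzero hder
      (hgen' i j) hfix ht
    have hval : envMatrixElement (C i) (C j) x₀ = 1 / 2 := by
      change star (C i) ⬝ᵥ (traceEnv x₀).mulVec (C j) = _
      rw [hx₀, traceEnv_kronecker, hρE, one_smul, ketBra_phaseState]
      simp only [Matrix.sum_mulVec, Matrix.smul_mulVec, Matrix.vecMulVec_mulVec, hC,
        dotProduct_sum, dotProduct_smul]
      simp
    rw [hval] at hz
    have hphase : Complex.exp (-((ω * t : ℝ) * (lam i - lam j) * Complex.I)) / 2 =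
        Complex.exp (t * (-(ω * (lam i - lam j)) : ℝ) * Complex.I) * (1 / 2) := by
      rw [mul_one_div]
      congr 2
      push_cast
      ring
    rw [hphase]
    exact hz
  -- The reduced state is supported on the code, hence is recovered from its four matrix elements
  -- between code words.
  have hexp : ∀ N : ℕ, controlledState M D ρE (ketBra (phaseState C lam 0)) ω t N =
      ∑ i, ∑ j, (envMatrixElement (C i) (C j) ((controlledRound M D ω (t / N))^[N] x₀)) •
        Matrix.vecMulVec (C i) (star (C j)) := by
    intro N
    have : Q * traceEnv ((controlledRound M D ω (t / N))^[N] x₀) * Q =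
        traceEnv ((controlledRound M D ω (t / N))^[N] x₀) := by
      -- For `N = 0` no control has acted, and the support comes from the initial state; afterwards
      -- it comes from the last correction.
      cases N with
      | zero =>
        rw [Function.iterate_zero, id, hx₀, traceEnv_kronecker, hρE, one_smul, hcode]
      | succ N =>
        rw [Function.iterate_succ_apply', controlledRound, traceEnv_onSecond, hDQ]
    change traceEnv ((controlledRound M D ω (t / N))^[N] x₀) = _
    rw [← this, codeProj_mul_mul]
    rfl
  simp only [hexp]
  rw [ketBra_phaseState]
  exact tendsto_finsetSum _ fun i _ => tendsto_finsetSum _ fun j _ =>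
    (hzeno i j).smul_const _

end Limit

end HiddenMarkovMetrology

end

/-! ### Assembly of the code, the recovery and the limit -/

theorem theorem1 {E P ι : Type*} [Fintype E] [DecidableEq E] [Nonempty E]
    [Fintype P] [DecidableEq P] [Fintype ι] {r : ℕ}
    (M : HiddenMarkovMetrology.Model E P r)
    (φ : OrthonormalBasis ι ℂ (EuclideanSpace ℂ E))
    (hG : M.G ∉ HiddenMarkovMetrology.extendedSpan M φ) :
    ∃ (dA : ℕ) (C₀ C₁ : P × Fin dA → ℂ) (lam₀ lam₁ : ℝ)
      (R : Matrix (P × Fin dA) (P × Fin dA) ℂ →ₗ[ℂ] Matrix (P × Fin dA) (P × Fin dA) ℂ),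
      HiddenMarkovMetrology.IsOrthonormalPair C₀ C₁ ∧
      HiddenMarkovMetrology.IsRecovery (HiddenMarkovMetrology.codeProj C₀ C₁) R ∧
      Matrix.mulVec (HiddenMarkovMetrology.codeProj C₀ C₁ *
          HiddenMarkovMetrology.liftP (Fin dA) M.G * HiddenMarkovMetrology.codeProj C₀ C₁) C₀ =
        (lam₀ : ℂ) • C₀ ∧
      Matrix.mulVec (HiddenMarkovMetrology.codeProj C₀ C₁ *
          HiddenMarkovMetrology.liftP (Fin dA) M.G * HiddenMarkovMetrology.codeProj C₀ C₁) C₁ =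
        (lam₁ : ℂ) • C₁ ∧
      lam₀ ≠ lam₁ ∧
      ∀ ρE : Matrix E E ℂ, HiddenMarkovMetrology.IsDensityMatrix ρE →
        ∃ ρ : ℝ → ℝ → Matrix (P × Fin dA) (P × Fin dA) ℂ,
          HiddenMarkovMetrology.IsFastControlState M
            (HiddenMarkovMetrology.qecStep (HiddenMarkovMetrology.codeProj C₀ C₁) R) ρE
            (HiddenMarkovMetrology.ketBra ((((1 / Real.sqrt 2 : ℝ) : ℂ)) • (C₀ + C₁))) ρ ∧
          ∀ ω t : ℝ, 0 ≤ t →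
            HiddenMarkovMetrology.HasQFIAt (fun w => ρ w t) ω (t ^ 2 * (lam₀ - lam₁) ^ 2) := by
  open HiddenMarkovMetrology in
  obtain ⟨dA, C, lam, hC, hlam, hS, hGC⟩ := exists_code (extendedSpan M φ)
    (one_mem_extendedSpan φ M) (fun X hX => conjTranspose_mem_extendedSpan φ M hX)
    M.G_isHermitian hG
  set Q := codeProj (C 0) (C 1) with hQ
  have hQQ : Q * Q = Q := codeProj_mul_self hC
  have hscalar : ∀ B ∈ extendedSpan M φ, ∃ c : ℂ, Q * liftP (Fin dA) B * Q = c • Q :=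
    fun B hB => by
      obtain ⟨c, hc⟩ := hS B hB
      exact ⟨c, codeProj_mul_mul_of_scalar C _ c hc⟩
  have hK : Q * liftP (Fin dA) M.G * Q =
      ∑ i, (lam i : ℂ) • Matrix.vecMulVec (C i) (star (C i)) := by
    rw [hQ, codeProj_mul_mul]
    simp [hGC]
  -- The errors to correct are all environment blocks of all jump operators. Both Knill–Laflamme
  -- conditions hold because these blocks and their products lie in the extended span.
  obtain ⟨R, hR, hRB⟩ := exists_qecStep Q (codeProj_conjTranspose _ _) hQQ
    (codeProj_mulVec hC 0) (by simpa using hC 0 0)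
    (fun a : Fin r × E × E => liftP (Fin dA) (blk (M.L a.1) a.2.1 a.2.2))
    (fun a => hscalar _ (blk_L_mem φ M _ _ _))
    (fun a b => by
      rw [← liftP_conjTranspose, ← liftP_mul]
      exact hscalar _ (blk_L_mul_blk_L_mem φ M _ _ _ _ _ _))
  have hcode : ∀ X, Q * X * Q = X → Q * X = X ∧ X * Q = X := fun X hX =>
    ⟨by rw [← hX, ← mul_assoc, ← mul_assoc, hQQ], by rw [← hX, mul_assoc, hQQ]⟩
  -- On either side of a code-supported operator, the control replaces `B` by the same scalar.
  have hcomm : ∀ B ∈ extendedSpan M φ, ∀ X, Q * X * Q = X →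
      qecStep Q R (liftP (Fin dA) B * X) = qecStep Q R (X * liftP (Fin dA) B) := by
    intro B hB X hX
    obtain ⟨c, hc⟩ := hscalar B hB
    rw [qecStep_mul_code hQQ R hX, qecStep_code_mul hQQ R hX, hc, smul_mul_assoc, mul_smul_comm,
      (hcode X hX).1, (hcode X hX).2]
  refine ⟨dA, C 0, C 1, lam 0, lam 1, R, ⟨by simpa using hC 0 0, by simpa using hC 1 1,
    by simpa using hC 0 1⟩, hR, ?_, ?_, hlam, fun ρE hρE =>
    ⟨fun ω t => ketBra (phaseState C lam (ω * t)), fun ω t ht => ?_, fun ω t _ =>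
      hasQFIAt_phaseState hC lam ω t⟩⟩
  · rw [← hQ, hK, sum_vecMulVec_mulVec hC fun i => (lam i : ℂ)]
  · rw [← hQ, hK, sum_vecMulVec_mulVec hC fun i => (lam i : ℂ)]
  · have hψ : ((1 / Real.sqrt 2 : ℝ) : ℂ) • (C 0 + C 1) = phaseState C lam 0 := by
      simp [phaseState]
    rw [hψ]
    refine tendsto_controlledState M hC lam _ (code_qecStep hQQ R hR.2)
      (fun X hX => qecStep_code hQQ R hX) ω (fun X hX => ?_) hρE.2 ht
    rw [← hK]
    refine map_traceEnv_lindbladian M (qecStep Q R) _ ω X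
      (fun e e' a b => hcomm _ (blk_HEP_mem φ M e e') _ (hX a b))
      (fun a b => qecStep_mul_code hQQ R (hX a b) _)
      (fun a b => qecStep_code_mul hQQ R (hX a b) _)
      (fun k e₀ e e' a b => hRB (k, e₀, e) (k, e₀, e') _ (hX a b))
      (fun k e₀ e e' a b => ?_)
    rw [← liftP_conjTranspose, ← liftP_mul]
    exact (hcomm _ (blk_L_mul_blk_L_mem φ M _ _ _ _ _ _) _ (hX a b)).symm
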